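/- Let $K$ be a field and let $A=\{u_1,\dots,u_n\}$ be a set of $n$ distinct monomials of the same degree $D\ge 1$ in $K[t_1,\dots,t_d]$. Let $K[A]\subseteq K[t_1,\dots,t_d]$ be the toric ring generated by $A$ over $K$, let $\mathfrak m$ be its graded maximal ideal, and let the toric ideal $I_A$ be the kernel of the $K$-algebra homomorphism $K[x_1,\dots,x_n]\to K[A]$, $x_i\mapsto u_i$. Suppose that $K[A]$ is strongly Koszul with respect to its monomial generators, i.e. $u_1,\dots,u_n$ is a minimal system of generators of $\mathfrak m$ such that for all $1\le i_1<\cdots<i_r\le n$ and all $j=1,\dots,r$ the colon ideal $(u_{i_1},\dots,u_{i_{j-1}}):u_{i_j}$ of $K[A]$ is generated by a subset of $\{u_1,\dots,u_n\}$. Then the following conditions are equivalent: (i) $K[A]$ is squarefree, i.e. it is isomorphic as a $K$-algebra to a semigroup ring generated by (finitely many) squarefree monomials in a polynomial ring over $K$; (ii) $I_A$ contains no nonzero binomial of the form $x_i^2-x_jx_k$ with $1\le i,j,k\le n$; (iii) $K[A]$ is compressed, i.e. for every ordering of the variables $x_1,\dots,x_n$ the initial ideal ${\rm in}_<(I_A)$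 with respect to the (graded) reverse lexicographic order $<$ induced by that ordering is radical: $\sqrt{{\rm in}_<(I_A)}={\rm in}_<(I_A)$. In particular, every squarefree strongly Koszul toric ring is compressed. -/

import Mathlib

open MvPolynomial

/-! ### Reverse lexicographic orders -/

/-- Exponent vectors in `n` variables, to be compared by the reverse lexicographic order with
`x_{ρ 0} < x_{ρ 1} < ⋯ < x_{ρ (n - 1)}`. -/
def RevLexSyn {n : ℕ} (_ρ : Equiv.Perm (Fin n)) : Type := Fin n →₀ ℕ

namespace RevLexSyn

variable {n : ℕ} (ρ : Equiv.Perm (Fin n))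

noncomputable instance : AddCommMonoid (RevLexSyn ρ) :=
  inferInstanceAs (AddCommMonoid (Fin n →₀ ℕ))

/-- The identity map to the synonym. -/
noncomputable def ofExp : (Fin n →₀ ℕ) ≃+ RevLexSyn ρ := AddEquiv.refl _

/-- Compare total degrees first; in case of a tie look at the smallest variable at which the two
exponents differ: the monomial with the *larger* exponent there is the *smaller* one. -/
noncomputable def key (a : RevLexSyn ρ) : ℕ ×ₗ Lex (Fin n → ℤ) :=
  toLex (Finsupp.degree ((ofExp ρ).symm a), toLex fun i => -(((ofExp ρ).symm a (ρ i) : ℕ) : ℤ))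

theorem key_injective : Function.Injective (key ρ) := by
  intro a b h
  have h2 := congrArg (fun p => ofLex (ofLex p).2) h
  apply (ofExp ρ).symm.injective
  ext i
  have := congrFun h2 (ρ.symm i)
  simpa [key] using this

theorem key_add (a b : RevLexSyn ρ) : key ρ (a + b) = key ρ a + key ρ b := by
  have h : (fun i => -(((ofExp ρ).symm (a + b) (ρ i) : ℕ) : ℤ)) =
      (fun i => -(((ofExp ρ).symm a (ρ i) : ℕ) : ℤ)) +
        fun i => -(((ofExp ρ).symm b (ρ i) : ℕ) : ℤ) := by
    funext i
    simp only [map_add, Finsupp.add_apply, Nat.cast_add, Pi.add_apply]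
    ring
  unfold key
  rw [h, map_add, map_add]
  rfl

noncomputable instance : LinearOrder (RevLexSyn ρ) := LinearOrder.lift' (key ρ) (key_injective ρ)

theorem lt_iff_key {a b : RevLexSyn ρ} : a < b ↔ key ρ a < key ρ b := Iff.rfl

theorem le_iff_key {a b : RevLexSyn ρ} : a ≤ b ↔ key ρ a ≤ key ρ b := Iff.rfl

instance : IsOrderedAddMonoid (RevLexSyn ρ) where
  add_le_add_left a b h c := by
    rw [le_iff_key] at h ⊢
    rw [key_add, key_add]
    exact add_le_add_left h _

theorem ofExp_monotone : Monotone (ofExp ρ) := by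
  intro a b h
  obtain ⟨c, rfl⟩ := exists_add_of_le h
  rcases eq_or_ne c 0 with rfl | hc
  · simp
  · apply le_of_lt
    rw [lt_iff_key, key, key, Prod.Lex.toLex_lt_toLex]
    left
    have : 0 < Finsupp.degree c := by
      rw [Nat.pos_iff_ne_zero, Ne, Finsupp.degree_eq_zero_iff]
      exact hc
    simpa using this

instance : WellFoundedLT (RevLexSyn ρ) :=
  ((ofExp_monotone ρ).wellQuasiOrderedLE_of_wellQuasiOrderedLE_of_surjective
    (ofExp ρ).surjective).to_wellFoundedLT

end RevLexSyn

/-- The (graded) reverse lexicographic order on monomials in `n` variables induced by the ordering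
`x_{ρ 0} < x_{ρ 1} < ⋯ < x_{ρ (n - 1)}` of the variables. -/
noncomputable def revLex {n : ℕ} (ρ : Equiv.Perm (Fin n)) : MonomialOrder (Fin n) where
  syn := RevLexSyn ρ
  toSyn := RevLexSyn.ofExp ρ
  toSyn_monotone := RevLexSyn.ofExp_monotone ρ

/-- The initial ideal of `I` with respect to a monomial order. -/
noncomputable def initialIdeal {σ K : Type*} [Field K] (m : MonomialOrder σ)
    (I : Ideal (MvPolynomial σ K)) : Ideal (MvPolynomial σ K) :=
  Ideal.span (m.leadingTerm '' (I : Set (MvPolynomial σ K)))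

/-! ### Toric rings and toric ideals -/

/-- The semigroup ring `K[A] ⊆ K[t_1, …, t_d]` generated by the monomials `t ^ a i`. -/
noncomputable def toricRing (K : Type*) [Field K] {n d : ℕ} (a : Fin n → Fin d →₀ ℕ) :
    Subalgebra K (MvPolynomial (Fin d) K) :=
  Algebra.adjoin K (Set.range fun i => monomial (a i) (1 : K))

/-- The generator `u_i = t ^ a i` as an element of `K[A]`. -/
noncomputable def toricGen (K : Type*) [Field K] {n d : ℕ} (a : Fin n → Fin d →₀ ℕ) (i : Fin n) :
    toricRing K a :=
  ⟨monomial (a i) 1, Algebra.subset_adjoin ⟨i, rfl⟩⟩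

/-- The toric ideal `I_A`: the kernel of `K[x_1, …, x_n] → K[A]`, `x_i ↦ u_i`. -/
noncomputable def toricIdeal (K : Type*) [Field K] {n d : ℕ} (a : Fin n → Fin d →₀ ℕ) :
    Ideal (MvPolynomial (Fin n) K) :=
  RingHom.ker (aeval (R := K) (toricGen K a))

/-- The graded maximal ideal of `K[A]`: the elements without constant term. -/
noncomputable def toricMaxIdeal (K : Type*) [Field K] {n d : ℕ} (a : Fin n → Fin d →₀ ℕ) :
    Ideal (toricRing K a) :=
  RingHom.ker ((constantCoeff (R := K) (σ := Fin d)).comp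
    (toricRing K a).val.toRingHom)

/-- `R`, with graded maximal ideal `𝔪`, is strongly Koszul with respect to the elements
`u_0, …, u_{n-1}`: they are a minimal system of generators of `𝔪`, and for all
`i_1 < ⋯ < i_r` and all `j` the colon ideal `(u_{i_1}, …, u_{i_{j-1}}) : u_{i_j}` is generated by
a subset of `{u_0, …, u_{n-1}}`. -/
structure IsStronglyKoszulWrt {R : Type*} [CommRing R] (𝔪 : Ideal R) {n : ℕ} (u : Fin n → R) :
    Prop where
  span_eq : Ideal.span (Set.range u) = 𝔪
  minimal : ∀ S : Set (Fin n), Ideal.span (u '' S) = 𝔪 → S = Set.univ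
  colon : ∀ (r : ℕ) (i : Fin r → Fin n), StrictMono i → ∀ j : Fin r,
    ∃ S : Set (Fin n),
      (Ideal.span ((fun k => u (i k)) '' {k | k < j})).colon {u (i j)} = Ideal.span (u '' S)

/-- A toric ring is strongly Koszul if it is so with respect to its monomial generators. -/
def IsStronglyKoszulToric (K : Type*) [Field K] {n d : ℕ} (a : Fin n → Fin d →₀ ℕ) : Prop :=
  IsStronglyKoszulWrt (toricMaxIdeal K a) (toricGen K a)

/-- `K[A]` is squarefree: it is isomorphic as a `K`-algebra to a semigroup ring generated by
squarefree monomials. -/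
def IsSquarefreeToric (K : Type*) [Field K] {n d : ℕ} (a : Fin n → Fin d →₀ ℕ) : Prop :=
  ∃ (p e : ℕ) (b : Fin p → Fin e →₀ ℕ), (∀ i l, b i l ≤ 1) ∧
    Nonempty (toricRing K a ≃ₐ[K] toricRing K b)

/-- `K[A]` is compressed: every reverse lexicographic initial ideal of `I_A` is radical. -/
def IsCompressedToric (K : Type*) [Field K] {n d : ℕ} (a : Fin n → Fin d →₀ ℕ) : Prop :=
  ∀ ρ : Equiv.Perm (Fin n),
    (initialIdeal (revLex ρ) (toricIdeal K a)).radical = initialIdeal (revLex ρ) (toricIdeal K a)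

/-! ### Configurations in a cancellative monoid -/

/-! Strong Koszulness is used only for the colon ideal of one generator by another: if `a i` divides
`h + a j` with `i ≠ j`, then some `a k` divides `h` and `a k + a j = a i + a l` (`QuadricConfig`).
The binomial condition becomes `MidpointFree`. Together they show that divisibility of a sum by a
generator depends only on the support of the sum (`genDvd_of_support_subset`).

Compressedness follows: a revlex reduction of a power of a monomial is a divisibility of its tail by
a generator, and the tail of the monomial itself has large enough support. Conversely, if `x_i² -
x_j x_k` lies in the toric ideal and `x_j` is made smallest, `x_i²` is initial but `x_i` is not.

For squarefreeness, let `F` be a face maximal among those avoiding a generator. All generators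
outside `F` agree modulo the group spanned by `F`, so the indicator of the complement of `F` is
additive on the monoid. These 0/1 functions separate its elements and serve as squarefree exponents.

The converse must handle isomorphisms that are not graded. Translating generators that occur in no
quadratic relation makes the origins correspond (`exists_augmented_equiv`). A relation `u_i² = u_j
u_k` then passes to linear parts, giving `F² = G H` with `G`, `H` multilinear. Unique factorization
makes `F` proportional to `G`, against the independence of the linear parts. -/

section Configuration

variable {ι M : Type*} [AddCommMonoid M]

/-- The element `∑ i, γ i • a i` of the monoid generated by the family `a`. -/
noncomputable def expSum (a : ι → M) : (ι →₀ ℕ) →ₗ[ℕ] M := Finsupp.linearCombination ℕ a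

@[simp]
theorem expSum_single (a : ι → M) (i : ι) (e : ℕ) : expSum a (Finsupp.single i e) = e • a i := by
  simp [expSum]

/-- The generator `a i` divides `h` in the monoid generated by `a`. -/
def GenDvd (a : ι → M) (i : ι) (h : M) : Prop := ∃ γ, h = a i + expSum a γ

theorem GenDvd.add {a : ι → M} {i : ι} {h : M} (hi : GenDvd a i h) (γ : ι →₀ ℕ) :
    GenDvd a i (h + expSum a γ) := by
  obtain ⟨δ, rfl⟩ := hi
  exact ⟨δ + γ, by rw [map_add, add_assoc]⟩

theorem GenDvd.mono {a : ι → M} {i : ι} {α β : ι →₀ ℕ} (hi : GenDvd a i (expSum a α))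
    (h : α ≤ β) : GenDvd a i (expSum a β) := by
  obtain ⟨γ, rfl⟩ := exists_add_of_le h
  rw [map_add]
  exact hi.add γ

theorem genDvd_of_mem_support (a : ι → M) {i : ι} {α : ι →₀ ℕ} (hi : i ∈ α.support) :
    GenDvd a i (expSum a α) := by
  have h : Finsupp.single i 1 ≤ α := by
    rw [Finsupp.single_le_iff]
    exact Nat.one_le_iff_ne_zero.2 (Finsupp.mem_support_iff.1 hi)
  exact GenDvd.mono ⟨0, by simp⟩ h

theorem Finsupp.induction_single_one {p : (ι →₀ ℕ) → Prop} (zero : p 0)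
    (step : ∀ i α, p α → p (α + Finsupp.single i 1)) (α : ι →₀ ℕ) : p α := by
  have h : ∀ (e : ℕ) i α, p α → p (α + Finsupp.single i e) := by
    intro e
    induction e with
    | zero => intro i α h; simpa using h
    | succ e ih =>
      intro i α h
      rw [Finsupp.single_add, ← add_assoc]
      exact step _ _ (ih i α h)
  induction α using Finsupp.induction with
  | zero => exact zero
  | single_add i e α _ _ ih => rw [add_comm]; exact h e i α ih

theorem Finsupp.exists_eq_single_of_degree_eq_one {γ : ι →₀ ℕ} (h : γ.degree = 1) :
    ∃ l, γ = Finsupp.single l 1 := by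
  have h0 : γ ≠ 0 := by
    rintro rfl
    simp at h
  obtain ⟨l, hl⟩ := Finsupp.support_nonempty_iff.2 h0
  have hle : Finsupp.single l 1 ≤ γ := by
    rw [Finsupp.single_le_iff]
    exact Nat.one_le_iff_ne_zero.2 (Finsupp.mem_support_iff.1 hl)
  obtain ⟨δ, rfl⟩ := exists_add_of_le hle
  refine ⟨l, ?_⟩
  rw [map_add, Finsupp.degree_single] at h
  rw [(Finsupp.degree_eq_zero_iff δ).1 (by omega), add_zero]

/-- A graded family of distinct generators such that the intersection of two distinct principal
ideals `a i + H` and `a j + H` of the generated monoid `H` is generated by sums of two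
generators. -/
structure QuadricConfig (a : ι → M) : Prop where
  inj : Function.Injective a
  graded : ∃ (deg : M →+ ℕ) (D : ℕ), 0 < D ∧ ∀ i, deg (a i) = D
  colon : ∀ (i j : ι) (α : ι →₀ ℕ), i ≠ j → GenDvd a i (expSum a α + a j) →
    ∃ k l, GenDvd a k (expSum a α) ∧ a k + a j = a i + a l

/-- No generator is the midpoint of two other ones. -/
def MidpointFree (a : ι → M) : Prop := ∀ i j k, a i + a i = a j + a k → j = i

namespace QuadricConfig

/-! ### Divisibility by a generator and supports -/

variable {a : ι → M}

theorem deg_expSum {deg : M →+ ℕ} {D : ℕ} (h : ∀ i, deg (a i) = D) (γ : ι →₀ ℕ) :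
    deg (expSum a γ) = γ.degree * D := by
  induction γ using Finsupp.induction_single_one with
  | zero => simp
  | step i α ih => simp [ih, h, add_mul]

theorem expSum_eq_zero (hq : QuadricConfig a) {γ : ι →₀ ℕ} (h : expSum a γ = 0) : γ = 0 := by
  obtain ⟨deg, D, hD, hdeg⟩ := hq.graded
  have := deg_expSum hdeg γ
  rw [h, map_zero] at this
  rcases Nat.mul_eq_zero.1 this.symm with h | h
  · exact (Finsupp.degree_eq_zero_iff γ).1 h
  · omega

theorem not_genDvd_zero (hq : QuadricConfig a) (i : ι) : ¬ GenDvd a i 0 := by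
  rintro ⟨γ, h⟩
  have : expSum a (Finsupp.single i 1 + γ) = 0 := by rw [map_add, expSum_single, one_smul, ← h]
  have := congrArg Finsupp.degree (hq.expSum_eq_zero this)
  simp at this

/-- After one copy of `a p` is peeled off, the colon condition yields a divisor of the shorter
multiple, which is `a p` by induction; the relation left over is a midpoint relation. -/
theorem eq_of_genDvd_nsmul (hq : QuadricConfig a) (hm : MidpointFree a) (p : ι) (e : ℕ) (j : ι)
    (h : GenDvd a j (e • a p)) : j = p := by
  induction e generalizing j with
  | zero => exact absurd (by simpa using h) (hq.not_genDvd_zero j)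
  | succ e ih =>
    by_contra hj
    rw [succ_nsmul, ← expSum_single] at h
    obtain ⟨k, l, hk, hl⟩ := hq.colon j p _ hj h
    obtain rfl := ih k (by simpa using hk)
    exact hj (hm _ _ _ hl)

/-- Peeling a summand `q` off `N` exchanges `j` for some `k` dividing the rest. Induction lowers the
multiplicity of `p` for `k`, and `a k + a q = a j + a l` leads back to `j`. -/
theorem genDvd_add_of_genDvd_add_nsmul (hq : QuadricConfig a) (hm : MidpointFree a) {p : ι} {e : ℕ}
    (N : ι →₀ ℕ) (j : ι) (h : GenDvd a j (expSum a N + e • a p)) :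
    GenDvd a j (expSum a N + a p) := by
  induction N using Finsupp.induction_single_one generalizing j with
  | zero =>
    obtain rfl := hq.eq_of_genDvd_nsmul hm p e j (by simpa using h)
    exact ⟨0, by simp⟩
  | step q N ih =>
    have e1 : ∀ x : M, expSum a (N + Finsupp.single q 1) + x = expSum a N + x + a q := by
      intro x; simp [add_right_comm]
    rw [e1] at h ⊢
    by_cases hj : j = q
    · subst hj
      exact ⟨N + Finsupp.single p 1, by simp [add_comm]⟩
    · rw [← expSum_single, ← map_add] at h
      obtain ⟨k, l, hk, hl⟩ := hq.colon j q _ hj h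
      obtain ⟨γ, hγ⟩ := ih k (by simpa using hk)
      refine ⟨Finsupp.single l 1 + γ, ?_⟩
      rw [hγ, add_right_comm, hl]
      simp [add_assoc]

theorem genDvd_of_support_subset (hq : QuadricConfig a) (hm : MidpointFree a) {j : ι}
    {α β : ι →₀ ℕ} (h : GenDvd a j (expSum a α)) (hs : α.support ⊆ β.support) :
    GenDvd a j (expSum a β) := by
  classical
  -- `N` collects the summands whose multiplicity has already been cut to one.
  have key : ∀ (T : Finset ι) (N : ι →₀ ℕ),
      GenDvd a j (expSum a (N + ∑ i ∈ T, Finsupp.single i (α i))) →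
      GenDvd a j (expSum a (N + ∑ i ∈ T, Finsupp.single i 1)) := by
    intro T
    induction T using Finset.induction with
    | empty => intro N h; simpa using h
    | insert i T hi ih =>
      intro N h
      rw [Finset.sum_insert hi, ← add_assoc] at h ⊢
      apply ih
      rw [add_right_comm, map_add, expSum_single, one_smul]
      apply hq.genDvd_add_of_genDvd_add_nsmul hm (e := α i)
      rwa [← expSum_single, ← map_add, add_right_comm]
  have h1 := key α.support 0 (by
    rw [zero_add]
    convert h using 2
    exact α.sum_single)
  rw [zero_add] at h1
  apply h1.mono
  intro i
  rw [Finsupp.finsetSum_apply]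
  simp only [Finsupp.single_apply, Finset.sum_ite_eq']
  split_ifs with hi
  · exact Nat.one_le_iff_ne_zero.2 (Finsupp.mem_support_iff.1 (hs hi))
  · exact Nat.zero_le _

/-! ### Faces -/

/-- A set of generators containing every divisor of every sum of its elements. -/
def _root_.IsGenFace (a : ι → M) (F : Set ι) : Prop :=
  ∀ (α : ι →₀ ℕ) (j : ι), (α.support : Set ι) ⊆ F → GenDvd a j (expSum a α) → j ∈ F

/-- The set of all divisors of sums of elements of `T`. -/
def _root_.genClosure (a : ι → M) (T : Set ι) : Set ι :=
  {j | ∃ α : ι →₀ ℕ, (α.support : Set ι) ⊆ T ∧ GenDvd a j (expSum a α)}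

theorem _root_.subset_genClosure (a : ι → M) (T : Set ι) : T ⊆ genClosure a T := by
  classical
  intro j hj
  refine ⟨Finsupp.single j 1, ?_, 0, by simp⟩
  intro i hi
  have := Finsupp.support_single_subset hi
  rw [Finset.mem_singleton] at this
  exact this ▸ hj

theorem _root_.isGenFace_genClosure (a : ι → M) (T : Set ι) : IsGenFace a (genClosure a T) := by
  classical
  have key : ∀ α : ι →₀ ℕ, (α.support : Set ι) ⊆ genClosure a T →
      ∃ β γ : ι →₀ ℕ, (β.support : Set ι) ⊆ T ∧ expSum a β = expSum a α + expSum a γ := by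
    intro α
    induction α using Finsupp.induction_single_one with
    | zero => intro _; exact ⟨0, 0, by simp, by simp⟩
    | step i α ih =>
      intro h
      have hs : ∀ k, k ∈ α.support ∨ k = i → k ∈ genClosure a T := by
        intro k hk
        apply h
        simp only [Finset.mem_coe, Finsupp.mem_support_iff, Finsupp.add_apply] at hk ⊢
        rcases hk with hk | rfl
        · omega
        · simp
      obtain ⟨β, γ, hβ, he⟩ := ih fun k hk => hs k (Or.inl hk)
      obtain ⟨β', hβ', γ', he'⟩ := hs i (Or.inr rfl)
      refine ⟨β + β', γ + γ', ?_, ?_⟩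
      · refine (Finset.coe_subset.2 Finsupp.support_add).trans ?_
        rw [Finset.coe_union]
        exact Set.union_subset hβ hβ'
      · simp only [map_add, he, he', expSum_single, one_smul]
        abel
  intro α j hα hj
  obtain ⟨β, γ, hβ, he⟩ := key α hα
  exact ⟨β, hβ, he ▸ hj.add γ⟩

/-- A face that is maximal among the faces avoiding some generator. -/
def _root_.IsMaxFace (a : ι → M) (F : Set ι) : Prop :=
  ∃ i, Maximal (fun G => IsGenFace a G ∧ i ∉ G) F

/-- Otherwise, cancelling `N` copies of `a i` makes it divide a sum over `F`, which would put `i` in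
`F`. -/
theorem _root_.IsGenFace.le_of_add_nsmul_eq [IsCancelAdd M] {F : Set ι} (hF : IsGenFace a F) {i : ι}
    (hi : i ∉ F) {f γ : ι →₀ ℕ} {N N' : ℕ} (hf : (f.support : Set ι) ⊆ F)
    (h : expSum a f + N • a i = N' • a i + expSum a γ) : N' ≤ N := by
  by_contra hN
  obtain ⟨m, rfl⟩ := Nat.exists_eq_add_of_lt (not_le.1 hN)
  apply hi
  refine hF f i hf ⟨m • Finsupp.single i 1 + γ, ?_⟩
  have : expSum a f + N • a i = (a i + expSum a (m • Finsupp.single i 1 + γ)) + N • a i := by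
    rw [h, add_smul, add_smul, map_add, map_nsmul]
    simp only [expSum_single, one_smul]
    abel
  exact add_right_cancel this

variable [IsCancelAdd M]

/-- Modulo `F`, every generator outside `F` equals `a i`. The proof takes the largest number `N` of
copies of `a i` that can be split off from `a j` up to `F`, and shows that the remainder lies in `F`
and that `N = 1`. -/
theorem exists_add_eq_of_maximal_face [Finite ι] (hq : QuadricConfig a) (hm : MidpointFree a)
    {F : Set ι} {i : ι} (hF : Maximal (fun G => IsGenFace a G ∧ i ∉ G) F) {j : ι} (hj : j ∉ F) :
    ∃ f f' : ι →₀ ℕ, (f.support : Set ι) ⊆ F ∧ (f'.support : Set ι) ⊆ F ∧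
      a j + expSum a f = a i + expSum a f' := by
  classical
  have hFf := hF.prop.1
  have hi := hF.prop.2
  -- every generator outside `F` is, up to `F`, divisible by `a i`
  have hdiv : ∀ k, k ∉ F → ∃ f γ : ι →₀ ℕ, (f.support : Set ι) ⊆ F ∧
      a k + expSum a f = a i + expSum a γ := by
    intro k hk
    have h1 : i ∈ genClosure a (insert k F) := by
      by_contra hc
      have := hF.le_of_ge (y := genClosure a (insert k F)) ⟨isGenFace_genClosure _ _, hc⟩
        ((Set.subset_insert _ _).trans (subset_genClosure _ _))
      exact hk (this (subset_genClosure _ _ (Set.mem_insert _ _)))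
    obtain ⟨α, hα, hd⟩ := h1
    -- `k` may occur often in `α`; by the support criterion one occurrence is enough.
    have hs : α.support ⊆ (Finsupp.single k 1 + α.erase k).support := by
      intro l hl
      by_cases hlk : l = k
      · subst hlk; simp
      · simpa [Finsupp.single_apply, hlk, Ne.symm hlk] using hl
    obtain ⟨γ, hγ⟩ := hq.genDvd_of_support_subset hm hd hs
    refine ⟨α.erase k, γ, ?_, by simpa using hγ⟩
    intro l hl
    rw [Finsupp.support_erase, Finset.coe_erase] at hl
    rcases hα hl.1 with h | h
    · exact absurd h hl.2
    · exact h
  let P : ℕ → Prop := fun N => ∃ f γ : ι →₀ ℕ, (f.support : Set ι) ⊆ F ∧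
    a j + expSum a f = N • a i + expSum a γ
  -- By Dickson's lemma an unbounded family has `γ N ≤ γ N'` for some `N < N'`; comparing the two
  -- equations contradicts `i ∉ F`.
  have hbdd : ∃ N, ¬ P N := by
    by_contra hc
    push Not at hc
    choose f γ hf hfγ using hc
    obtain ⟨N, N', hlt, hle⟩ := wellQuasiOrdered_le γ
    obtain ⟨δ, hδ⟩ := exists_add_of_le hle
    have h2 : expSum a (f N') + N • a i = N' • a i + expSum a (f N + δ) := by
      have : a j + expSum a (f N) + (expSum a (f N') + N • a i) =
          a j + expSum a (f N) + (N' • a i + expSum a (f N + δ)) := by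
        calc _ = (a j + expSum a (f N')) + (expSum a (f N) + N • a i) := by abel
          _ = N' • a i + expSum a (γ N') + (expSum a (f N) + N • a i) := by rw [hfγ]
          _ = (N • a i + expSum a (γ N)) + (N' • a i + expSum a (f N + δ)) := by
            rw [hδ, map_add, map_add]; abel
          _ = _ := by rw [hfγ]
      exact add_left_cancel this
    have := hFf.le_of_add_nsmul_eq hi (hf N') h2
    omega
  have h1 : P 1 := by
    obtain ⟨f, γ, h⟩ := hdiv j hj
    exact ⟨f, γ, by simpa using h⟩
  obtain ⟨N, hN1, ⟨f, γ, hf, hfγ⟩, hN⟩ : ∃ N, 1 ≤ N ∧ P N ∧ ¬ P (N + 1) := by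
    by_contra hc
    push Not at hc
    obtain ⟨N, hN⟩ := hbdd
    rcases Nat.eq_zero_or_pos N with rfl | hpos
    · exact hN ⟨0, Finsupp.single j 1, by simp, by simp⟩
    · exact hN (Nat.le_induction h1 (fun k hk hP => hc k hk hP) N hpos)
  -- A summand outside `F` would supply one more copy of `a i`.
  have hγ : (γ.support : Set ι) ⊆ F := by
    intro k hk
    by_contra hkF
    obtain ⟨δ, hδ⟩ := genDvd_of_mem_support a hk
    obtain ⟨f', γ', hf', hfγ'⟩ := hdiv k hkF
    refine hN ⟨f + f', γ' + δ, ?_, ?_⟩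
    · refine (Finset.coe_subset.2 Finsupp.support_add).trans ?_
      rw [Finset.coe_union]
      exact Set.union_subset hf hf'
    · rw [map_add, ← add_assoc, hfγ, hδ]
      calc _ = N • a i + (a k + expSum a f') + expSum a δ := by abel
        _ = _ := by rw [hfγ', add_smul, map_add]; abel
  -- `a j` divides `γ + N • a i`, so a single copy of `a i` suffices; this will force `N ≤ 1`.
  have hd : GenDvd a j (expSum a (γ + Finsupp.single i 1)) := by
    rw [map_add, expSum_single, one_smul]
    apply hq.genDvd_add_of_genDvd_add_nsmul hm (e := N)
    exact ⟨f, by rw [hfγ, add_comm]⟩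
  obtain ⟨δ, hδ⟩ := hd
  have hle : N ≤ 1 := by
    refine hFf.le_of_add_nsmul_eq hi (f := γ + f) (γ := γ + δ) ?_ ?_
    · refine (Finset.coe_subset.2 Finsupp.support_add).trans ?_
      rw [Finset.coe_union]
      exact Set.union_subset hγ hf
    · rw [map_add, map_add, one_smul]
      rw [map_add, expSum_single, one_smul] at hδ
      calc _ = (expSum a γ + a i) + expSum a f := by abel
        _ = (a j + expSum a f) + expSum a δ := by rw [hδ]; abel
        _ = _ := by rw [hfγ]; abel
  obtain rfl : N = 1 := le_antisymm hle hN1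
  exact ⟨f, γ, hf, hγ, by simpa using hfγ⟩

/-! ### Additive 0/1 functions from maximal faces -/

open scoped Classical in
/-- The indicator function of the complement of `F`. -/
noncomputable def _root_.faceInd (F : Set ι) (i : ι) : ℕ := if i ∈ F then 0 else 1

theorem _root_.faceInd_le_one (F : Set ι) (i : ι) : faceInd F i ≤ 1 := by
  unfold faceInd; split_ifs <;> simp

theorem _root_.faceInd_of_mem {F : Set ι} {i : ι} (h : i ∈ F) : faceInd F i = 0 := if_pos h

theorem _root_.faceInd_of_notMem {F : Set ι} {i : ι} (h : i ∉ F) : faceInd F i = 1 := if_neg h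

theorem _root_.expSum_faceInd_eq_zero_iff {F : Set ι} {α : ι →₀ ℕ} :
    expSum (faceInd F) α = 0 ↔ (α.support : Set ι) ⊆ F := by
  rw [expSum, Finsupp.linearCombination_apply, Finsupp.sum, Finset.sum_eq_zero_iff]
  refine forall₂_congr fun i hi => ?_
  by_cases h : i ∈ F
  · simp [faceInd_of_mem h, h]
  · simpa [faceInd_of_notMem h, h] using hi

/-- Modulo `F`, a sum equals as many copies of `a i` as it has summands outside `F`. This number is
determined by the sum, since extra copies of `a i` cannot be absorbed by `F`. -/
theorem _root_.IsMaxFace.expSum_faceInd_eq [Finite ι] (hq : QuadricConfig a) (hm : MidpointFree a)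
    {F : Set ι} (hF : IsMaxFace a F) {α β : ι →₀ ℕ} (h : expSum a α = expSum a β) :
    expSum (faceInd F) α = expSum (faceInd F) β := by
  classical
  obtain ⟨i, hF⟩ := hF
  have hi := hF.prop.2
  have hadd : ∀ {f g : ι →₀ ℕ}, (f.support : Set ι) ⊆ F → (g.support : Set ι) ⊆ F →
      ((f + g).support : Set ι) ⊆ F := by
    intro f g hf hg
    refine (Finset.coe_subset.2 Finsupp.support_add).trans ?_
    rw [Finset.coe_union]
    exact Set.union_subset hf hg
  have key : ∀ α : ι →₀ ℕ, ∃ f f' : ι →₀ ℕ, (f.support : Set ι) ⊆ F ∧ (f'.support : Set ι) ⊆ F ∧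
      expSum a α + expSum a f = expSum (faceInd F) α • a i + expSum a f' := by
    intro α
    induction α using Finsupp.induction_single_one with
    | zero => exact ⟨0, 0, by simp, by simp, by simp⟩
    | step j α ih =>
      obtain ⟨f, f', hf, hf', h⟩ := ih
      by_cases hj : j ∈ F
      · refine ⟨f, f' + Finsupp.single j 1, hf, hadd hf' ?_, ?_⟩
        · intro k hk
          have := Finsupp.support_single_subset hk
          rw [Finset.mem_singleton] at this
          exact this ▸ hj
        · simp only [map_add, expSum_single, one_smul, faceInd_of_mem hj, add_zero]
          rw [add_right_comm, h, add_assoc]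
      · obtain ⟨g, g', hg, hg', h'⟩ := exists_add_eq_of_maximal_face hq hm hF hj
        refine ⟨f + g, f' + g', hadd hf hg, hadd hf' hg', ?_⟩
        simp only [map_add, expSum_single, one_smul, faceInd_of_notMem hj, add_smul]
        rw [add_add_add_comm, h, h']
        abel
  have hle : ∀ {α β : ι →₀ ℕ}, expSum a α = expSum a β →
      expSum (faceInd F) α ≤ expSum (faceInd F) β := by
    intro α β h
    obtain ⟨f, f', hf, hf', h1⟩ := key α
    obtain ⟨g, g', hg, hg', h2⟩ := key β
    refine hF.prop.1.le_of_add_nsmul_eq hi (f := f + g') (γ := f' + g) (hadd hf hg') ?_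
    rw [map_add, map_add]
    calc _ = (expSum (faceInd F) β • a i + expSum a g') + expSum a f := by abel
      _ = (expSum a α + expSum a f) + expSum a g := by rw [← h2, h]; abel
      _ = _ := by rw [h1]; abel
  exact le_antisymm (hle h) (hle h.symm)

/-- If `i` occurs in `β` but not in the closure of the support of `α`, a maximal face containing
that closure and avoiding `i` has an indicator vanishing on `α` but not on `β`. Hence every summand
of `β` divides the sum of `α`, and can be cancelled. -/
theorem expSum_eq_of_faceInd [Finite ι] (hq : QuadricConfig a) (hm : MidpointFree a)
    {α β : ι →₀ ℕ}
    (h : ∀ F, IsMaxFace a F → expSum (faceInd F) α = expSum (faceInd F) β) :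
    expSum a α = expSum a β := by
  classical
  have hmem : ∀ {α β : ι →₀ ℕ},
      (∀ F, IsMaxFace a F → expSum (faceInd F) α = expSum (faceInd F) β) →
      ∀ i ∈ β.support, GenDvd a i (expSum a α) := by
    intro α β h i hi
    have hcl : i ∈ genClosure a α.support := by
      by_contra hc
      obtain ⟨F, hle, hF⟩ := (Set.toFinite {G | IsGenFace a G ∧ i ∉ G}).exists_le_maximal
        (show genClosure a α.support ∈ {G | IsGenFace a G ∧ i ∉ G} from
          ⟨isGenFace_genClosure a _, hc⟩)
      have h0 := expSum_faceInd_eq_zero_iff.2 ((subset_genClosure a _).trans hle)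
      rw [h F ⟨i, hF⟩] at h0
      exact hF.prop.2 (expSum_faceInd_eq_zero_iff.1 h0 hi)
    obtain ⟨γ, hγ, hd⟩ := hcl
    exact hq.genDvd_of_support_subset hm hd (Finset.coe_subset.1 hγ)
  induction β using Finsupp.induction_single_one generalizing α with
  | zero =>
    have : α = 0 := by
      rw [← Finsupp.support_eq_empty, Finset.eq_empty_iff_forall_notMem]
      intro i hi
      have := hmem (fun F hF => (h F hF).symm) i hi
      rw [map_zero] at this
      exact hq.not_genDvd_zero i this
    rw [this]
  | step i β ih =>
    obtain ⟨γ, hγ⟩ := hmem h i (by simp)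
    have h1 : expSum a α = expSum a (γ + Finsupp.single i 1) := by simp [hγ, add_comm]
    rw [h1, map_add, map_add, ih]
    intro F hF
    have := h F hF
    rw [hF.expSum_faceInd_eq hq hm h1, map_add, map_add] at this
    exact Nat.add_right_cancel this

end QuadricConfig

end Configuration

/-! ### Toric rings -/

section ToricRing

variable {K : Type*} [Field K] {n d : ℕ} {a : Fin n → Fin d →₀ ℕ}

/-! ### Toric rings as monoid algebras -/

theorem coe_aeval_toricGen_monomial (α : Fin n →₀ ℕ) (c : K) :
    ((aeval (toricGen K a) (monomial α c) : toricRing K a) : MvPolynomial (Fin d) K) =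
      monomial (expSum a α) c := by
  induction α using Finsupp.induction_single_one with
  | zero => simp [algebraMap_eq]
  | step i α ih =>
    have h : monomial (α + Finsupp.single i 1) c =
        monomial α c * (X i : MvPolynomial (Fin n) K) := by
      rw [X, monomial_mul, mul_one]
    rw [h, map_mul, MulMemClass.coe_mul, ih, aeval_X, map_add, expSum_single, one_smul]
    simp [toricGen]

theorem coe_aeval_toricGen (f : MvPolynomial (Fin n) K) :
    ((aeval (toricGen K a) f : toricRing K a) : MvPolynomial (Fin d) K) =
      ∑ α ∈ f.support, monomial (expSum a α) (coeff α f) := by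
  conv_lhs => rw [f.as_sum]
  rw [map_sum, AddSubmonoidClass.coe_finsetSum]
  exact Finset.sum_congr rfl fun α _ => coe_aeval_toricGen_monomial α _

theorem aeval_toricGen_surjective :
    Function.Surjective (aeval (toricGen K a) : MvPolynomial (Fin n) K →ₐ[K] toricRing K a) := by
  rintro ⟨x, hx⟩
  induction hx using Algebra.adjoin_induction with
  | mem x h =>
    obtain ⟨i, rfl⟩ := h
    exact ⟨X i, by rw [aeval_X]; rfl⟩
  | algebraMap c => exact ⟨C c, by rw [aeval_C]; rfl⟩
  | add x y _ _ hx hy =>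
    obtain ⟨f, hf⟩ := hx
    obtain ⟨g, hg⟩ := hy
    exact ⟨f + g, by rw [map_add, hf, hg]; rfl⟩
  | mul x y _ _ hx hy =>
    obtain ⟨f, hf⟩ := hx
    obtain ⟨g, hg⟩ := hy
    exact ⟨f * g, by rw [map_mul, hf, hg]; rfl⟩

/-- The monomial with exponent `expSum a α`, as an element of the toric ring. -/
noncomputable def toricMon (K : Type*) [Field K] (a : Fin n → Fin d →₀ ℕ) (α : Fin n →₀ ℕ) :
    toricRing K a :=
  aeval (toricGen K a) (monomial α (1 : K))

@[simp]
theorem coe_toricMon (α : Fin n →₀ ℕ) :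
    (toricMon K a α : MvPolynomial (Fin d) K) = monomial (expSum a α) 1 :=
  coe_aeval_toricGen_monomial α 1

@[simp]
theorem coe_toricGen (i : Fin n) :
    (toricGen K a i : MvPolynomial (Fin d) K) = monomial (a i) 1 := rfl

theorem exists_expSum_of_coeff_ne_zero (x : toricRing K a) {s : Fin d →₀ ℕ}
    (hs : coeff s (x : MvPolynomial (Fin d) K) ≠ 0) : ∃ α, s = expSum a α := by
  obtain ⟨f, rfl⟩ := aeval_toricGen_surjective x
  rw [coe_aeval_toricGen, coeff_sum] at hs
  obtain ⟨α, _, h⟩ := Finset.exists_ne_zero_of_sum_ne_zero hs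
  rw [coeff_monomial] at h
  exact ⟨α, by by_contra hc; exact h (if_neg (Ne.symm hc))⟩

theorem exists_add_expSum_of_mem_span {S : Set (Fin n)} {x : toricRing K a}
    (hx : x ∈ Ideal.span (toricGen K a '' S)) {s : Fin d →₀ ℕ}
    (hs : coeff s (x : MvPolynomial (Fin d) K) ≠ 0) : ∃ k ∈ S, GenDvd a k s := by
  induction hx using Submodule.span_induction generalizing s with
  | mem x h =>
    obtain ⟨k, hk, rfl⟩ := h
    rw [coe_toricGen, coeff_monomial] at hs
    refine ⟨k, hk, 0, ?_⟩
    by_contra hc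
    exact hs (if_neg fun h => hc (by simp [h]))
  | zero => simp at hs
  | add x y _ _ hx hy =>
    rw [AddMemClass.coe_add, coeff_add] at hs
    by_cases h : coeff s (x : MvPolynomial (Fin d) K) = 0
    · exact hy (by simpa [h] using hs)
    · exact hx h
  | smul r x _ hx =>
    rw [smul_eq_mul, MulMemClass.coe_mul, coeff_mul] at hs
    obtain ⟨⟨p, q⟩, hpq, h⟩ := Finset.exists_ne_zero_of_sum_ne_zero hs
    rw [Finset.HasAntidiagonal.mem_antidiagonal] at hpq
    obtain ⟨k, hk, hd⟩ := hx (right_ne_zero_of_mul h)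
    obtain ⟨α, rfl⟩ := exists_expSum_of_coeff_ne_zero r (left_ne_zero_of_mul h)
    exact ⟨k, hk, by rw [← hpq, add_comm]; exact hd.add α⟩

/-- Relations between the monomials of a toric ring persist under any substitution that depends
only on the exponents. -/
theorem sum_smul_eq_zero_of_mem_toricIdeal {T : Type*} [AddCommGroup T] [Module K T]
    {f : MvPolynomial (Fin n) K} (hf : f ∈ toricIdeal K a) (θ : (Fin d →₀ ℕ) → T) :
    ∑ α ∈ f.support, coeff α f • θ (expSum a α) = 0 := by
  have h0 : ((aeval (toricGen K a) f : toricRing K a) : MvPolynomial (Fin d) K) = 0 := by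
    rw [toricIdeal, RingHom.mem_ker] at hf
    exact congrArg Subtype.val hf
  rw [coe_aeval_toricGen] at h0
  have h1 := congrArg ((basisMonomials (Fin d) K).constr K θ) h0
  rw [map_zero, map_sum] at h1
  rw [← h1]
  refine Finset.sum_congr rfl fun α _ => ?_
  have : monomial (expSum a α) (coeff α f) =
      coeff α f • basisMonomials (Fin d) K (expSum a α) := by
    rw [coe_basisMonomials, smul_monomial, smul_eq_mul, mul_one]
  rw [this, map_smul, Module.Basis.constr_basis]

theorem exists_toricRing_lift {T : Type*} [CommRing T] [Algebra K T] (t : Fin n → T)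
    (ht : ∀ α β : Fin n →₀ ℕ, expSum a α = expSum a β →
      (α.prod fun i e => t i ^ e) = β.prod fun i e => t i ^ e) :
    ∃ ψ : toricRing K a →ₐ[K] T, ∀ i, ψ (toricGen K a i) = t i := by
  classical
  -- The value comes from a chosen representation; the default 0 off the monoid plays no role.
  let θ : (Fin d →₀ ℕ) → T := fun s =>
    if h : ∃ γ, expSum a γ = s then h.choose.prod fun i e => t i ^ e else 0
  have hθ : ∀ α, θ (expSum a α) = α.prod fun i e => t i ^ e := by
    intro α
    have h : ∃ γ, expSum a γ = expSum a α := ⟨α, rfl⟩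
    simp only [θ, dif_pos h]
    exact ht _ _ h.choose_spec
  have hker : RingHom.ker (aeval (R := K) (toricGen K a)).toRingHom ≤
      RingHom.ker (aeval (R := K) t).toRingHom := by
    intro f hf
    have h := sum_smul_eq_zero_of_mem_toricIdeal (a := a) (f := f) hf θ
    rw [RingHom.mem_ker]
    change aeval t f = 0
    rw [← h, aeval_def, eval₂_eq]
    refine Finset.sum_congr rfl fun α _ => ?_
    rw [hθ, Algebra.smul_def]
    rfl
  refine ⟨AlgHom.liftOfSurjective _ aeval_toricGen_surjective (aeval t) hker, fun i => ?_⟩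
  have := AlgHom.liftOfSurjective_apply _ (aeval_toricGen_surjective (K := K) (a := a)) _ hker (X i)
  rwa [aeval_X, aeval_X] at this

theorem toricRing_algHom_ext {T : Type*} [CommRing T] [Algebra K T]
    {φ ψ : toricRing K a →ₐ[K] T} (h : ∀ i, φ (toricGen K a i) = ψ (toricGen K a i)) : φ = ψ := by
  have h1 : φ.comp (aeval (toricGen K a)) = ψ.comp (aeval (toricGen K a)) := by
    ext i; simp [h]
  ext x
  obtain ⟨f, rfl⟩ := aeval_toricGen_surjective x
  exact DFunLike.congr_fun h1 f

theorem prod_toricGen_pow (α : Fin n →₀ ℕ) :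
    (α.prod fun i e => toricGen K a i ^ e) = toricMon K a α := by
  rw [toricMon, aeval_monomial, map_one, one_mul]

theorem toricMon_congr {α β : Fin n →₀ ℕ} (h : expSum a α = expSum a β) :
    toricMon K a α = toricMon K a β := by
  apply Subtype.ext
  rw [coe_toricMon, coe_toricMon, h]

theorem nonempty_toricRing_equiv {e : ℕ} {b : Fin n → Fin e →₀ ℕ}
    (h : ∀ α β : Fin n →₀ ℕ, expSum a α = expSum a β ↔ expSum b α = expSum b β) :
    Nonempty (toricRing K a ≃ₐ[K] toricRing K b) := by
  obtain ⟨φ, hφ⟩ := exists_toricRing_lift (K := K) (a := a) (toricGen K b) fun α β hαβ => by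
    rw [prod_toricGen_pow, prod_toricGen_pow, toricMon_congr ((h _ _).1 hαβ)]
  obtain ⟨ψ, hψ⟩ := exists_toricRing_lift (K := K) (a := b) (toricGen K a) fun α β hαβ => by
    rw [prod_toricGen_pow, prod_toricGen_pow, toricMon_congr ((h _ _).2 hαβ)]
  exact ⟨AlgEquiv.ofAlgHom φ ψ (toricRing_algHom_ext fun i => by simp [hφ, hψ])
    (toricRing_algHom_ext fun i => by simp [hφ, hψ])⟩

theorem monomial_sub_monomial_mem_toricIdeal {α β : Fin n →₀ ℕ} :
    (monomial α 1 - monomial β 1 : MvPolynomial (Fin n) K) ∈ toricIdeal K a ↔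
      expSum a α = expSum a β := by
  rw [toricIdeal, RingHom.mem_ker, map_sub, sub_eq_zero, Subtype.ext_iff,
    coe_aeval_toricGen_monomial, coe_aeval_toricGen_monomial]
  exact (monomial_left_injective one_ne_zero).eq_iff

theorem not_exists_sq_sub_mem_toricIdeal_iff (ha : Function.Injective a) :
    (¬ ∃ i j k : Fin n, (X i ^ 2 - X j * X k : MvPolynomial (Fin n) K) ≠ 0 ∧
      (X i ^ 2 - X j * X k : MvPolynomial (Fin n) K) ∈ toricIdeal K a) ↔ MidpointFree a := by
  have hX : ∀ i j k : Fin n, (X i ^ 2 - X j * X k : MvPolynomial (Fin n) K) =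
      monomial (Finsupp.single i 1 + Finsupp.single i 1) 1 -
        monomial (Finsupp.single j 1 + Finsupp.single k 1) 1 := by
    intro i j k
    rw [sq, X, X, X, monomial_mul, monomial_mul, mul_one]
  have hmem : ∀ i j k : Fin n, (X i ^ 2 - X j * X k : MvPolynomial (Fin n) K) ∈ toricIdeal K a ↔
      a i + a i = a j + a k := by
    intro i j k
    rw [hX, monomial_sub_monomial_mem_toricIdeal]
    simp
  push Not
  refine forall₃_congr fun i j k => ?_
  rw [hmem]
  constructor
  · intro h he
    by_contra hj
    refine h (fun h0 => ?_) he
    rw [hX, sub_eq_zero, (monomial_left_injective one_ne_zero).eq_iff] at h0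
    have := DFunLike.congr_fun h0 j
    simp [Finsupp.single_apply, Ne.symm hj] at this
    omega
  · intro h h0 he
    obtain rfl := h he
    obtain rfl := ha (add_left_cancel he)
    exact h0 (by ring)

/-- A monomial in `(u_i) : u_j` is divisible by one of the generators `u_k` of that colon ideal, and
`u_k u_j ∈ (u_i)` is a quadratic relation by degree. -/
theorem quadricConfig_of_isStronglyKoszulToric (ha : Function.Injective a) {D : ℕ} (hD : 0 < D)
    (hdeg : ∀ i, (a i).degree = D) (hK : IsStronglyKoszulToric K a) : QuadricConfig a := by
  have hlin : ∀ {k j i : Fin n} {γ : Fin n →₀ ℕ}, a k + a j = a i + expSum a γ →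
      ∃ l, a k + a j = a i + a l := by
    intro k j i γ h
    have h1 := congrArg Finsupp.degree h
    have h2 := QuadricConfig.deg_expSum (deg := Finsupp.degree) hdeg γ
    rw [map_add, map_add, hdeg, hdeg, hdeg, h2] at h1
    have h3 : γ.degree = 1 := by
      have : D * 1 = D * γ.degree := by linarith
      exact (Nat.eq_of_mul_eq_mul_left hD this).symm
    obtain ⟨l, rfl⟩ := Finsupp.exists_eq_single_of_degree_eq_one h3
    exact ⟨l, by simpa using h⟩
  have hlt : ∀ (i j : Fin n) (α : Fin n →₀ ℕ), i < j → GenDvd a i (expSum a α + a j) →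
      ∃ k l, GenDvd a k (expSum a α) ∧ a k + a j = a i + a l := by
    intro i j α hij ⟨γ, hγ⟩
    obtain ⟨S, hS⟩ := hK.colon 2 ![i, j] (by
      intro x y hxy
      fin_cases x <;> fin_cases y <;> simp_all) 1
    have himg : (fun k => toricGen K a (![i, j] k)) '' {k | k < 1} = toricGen K a '' {i} := by
      ext x
      simp only [Set.mem_image, Set.mem_ofPred_eq, Set.mem_singleton_iff]
      constructor
      · rintro ⟨k, hk, rfl⟩
        fin_cases k <;> simp_all
      · rintro ⟨k, rfl, rfl⟩
        exact ⟨0, by simp, by simp⟩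
    rw [himg] at hS
    have hmem : toricMon K a α ∈ Ideal.span (toricGen K a '' S) := by
      rw [← hS, Submodule.mem_colon_singleton, smul_eq_mul]
      have : toricMon K a α * toricGen K a (![i, j] 1) = toricMon K a γ * toricGen K a i := by
        apply Subtype.ext
        simp only [MulMemClass.coe_mul, coe_toricMon, coe_toricGen, monomial_mul, mul_one]
        simp [hγ, add_comm]
      rw [this]
      exact Ideal.mul_mem_left _ _ (Ideal.subset_span ⟨i, rfl, rfl⟩)
    obtain ⟨k, hk, hd⟩ := exists_add_expSum_of_mem_span hmem (s := expSum a α) (by simp)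
    have hmem' : toricGen K a k ∈ Ideal.span (toricGen K a '' S) :=
      Ideal.subset_span ⟨k, hk, rfl⟩
    rw [← hS, Submodule.mem_colon_singleton, smul_eq_mul] at hmem'
    obtain ⟨_, rfl, δ, hδ⟩ := exists_add_expSum_of_mem_span hmem' (s := a k + a j) (by
      simp [monomial_mul])
    obtain ⟨l, hl⟩ := hlin hδ
    exact ⟨k, l, hd, hl⟩
  refine ⟨ha, ⟨Finsupp.degree, D, hD, hdeg⟩, fun i j α hij h => ?_⟩
  rcases lt_or_gt_of_ne hij with hlt' | hgt
  · exact hlt i j α hlt' h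
  -- The colon hypothesis covers increasing pairs only; here it is applied to the same equation with
  -- `i` and `j` exchanged, and `a j` is then cancelled.
  · obtain ⟨γ, hγ⟩ := h
    obtain ⟨k, l, ⟨δ, hδ⟩, hl⟩ := hlt j i γ hgt ⟨α, by rw [add_comm, ← hγ, add_comm]⟩
    refine ⟨l, k, ⟨δ, ?_⟩, by rw [add_comm, ← hl, add_comm]⟩
    have : expSum a α + a j = a l + expSum a δ + a j := by
      rw [hγ, hδ, ← add_assoc, add_comm (a i), hl]
      abel
    exact add_right_cancel this

theorem isSquarefreeToric_of_midpointFree (hq : QuadricConfig a) (hm : MidpointFree a) :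
    IsSquarefreeToric K a := by
  classical
  let 𝓕 := {F : Set (Fin n) // IsMaxFace a F}
  obtain ⟨e, ⟨E⟩⟩ := Finite.exists_equiv_fin 𝓕
  let b : Fin n → Fin e →₀ ℕ := fun i =>
    Finsupp.equivFunOnFinite.symm fun l => faceInd (E.symm l).1 i
  have hb : ∀ (α : Fin n →₀ ℕ) l, expSum b α l = expSum (faceInd (E.symm l).1) α := by
    intro α l
    induction α using Finsupp.induction_single_one with
    | zero => simp
    | step i α ih => simp [ih, b]
  refine ⟨n, e, b, fun i l => faceInd_le_one _ i, nonempty_toricRing_equiv fun α β => ?_⟩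
  constructor
  · intro h
    ext l
    rw [hb, hb]
    exact (E.symm l).2.expSum_faceInd_eq hq hm h
  · intro h
    refine hq.expSum_eq_of_faceInd hm fun F hF => ?_
    have := DFunLike.congr_fun h (E ⟨F, hF⟩)
    rw [hb, hb, E.symm_apply_apply] at this
    exact this

end ToricRing

/-! ### Initial ideals of toric ideals -/

section InitialIdeal

variable {K : Type*} [Field K] {n d : ℕ} {a : Fin n → Fin d →₀ ℕ}

/-- The exponents that are not minimal in their fiber with respect to a monomial order. -/
def nonstandardExps (m : MonomialOrder (Fin n)) (a : Fin n → Fin d →₀ ℕ) : Set (Fin n →₀ ℕ) :=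
  {α | ∃ β, expSum a β = expSum a α ∧ m.toSyn β < m.toSyn α}

theorem nonstandardExps_mono {m : MonomialOrder (Fin n)} {α β : Fin n →₀ ℕ}
    (hα : α ∈ nonstandardExps m a) (h : α ≤ β) : β ∈ nonstandardExps m a := by
  obtain ⟨γ, rfl⟩ := exists_add_of_le h
  obtain ⟨δ, h1, h2⟩ := hα
  refine ⟨δ + γ, by rw [map_add, map_add, h1], ?_⟩
  rw [map_add, map_add]
  exact add_lt_add_left h2 _

theorem monomial_mem_initialIdeal {m : MonomialOrder (Fin n)} {α : Fin n →₀ ℕ}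
    (hα : α ∈ nonstandardExps m a) :
    (monomial α 1 : MvPolynomial (Fin n) K) ∈ initialIdeal m (toricIdeal K a) := by
  classical
  obtain ⟨β, h1, h2⟩ := hα
  apply Ideal.subset_span
  refine ⟨monomial α 1 - monomial β 1, monomial_sub_monomial_mem_toricIdeal.2 h1.symm, ?_⟩
  have hlt : m.toSyn (m.degree (monomial β (1 : K))) <
      m.toSyn (m.degree (monomial α (1 : K))) := by
    rwa [m.degree_monomial, m.degree_monomial, if_neg one_ne_zero, if_neg one_ne_zero]
  rw [MonomialOrder.leadingTerm, m.leadingCoeff_sub_of_lt hlt, m.degree_sub_of_lt hlt,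
    m.leadingCoeff_monomial, m.degree_monomial, if_neg one_ne_zero]

/-- The coefficients of an element of the toric ideal sum to zero over each fiber of `expSum`, so
its leading exponent shares its fiber with a smaller exponent of the support. -/
theorem mem_initialIdeal_iff {m : MonomialOrder (Fin n)} {f : MvPolynomial (Fin n) K} :
    f ∈ initialIdeal m (toricIdeal K a) ↔ ∀ α ∈ f.support, α ∈ nonstandardExps m a := by
  classical
  constructor
  · intro hf
    have hle : initialIdeal m (toricIdeal K a) ≤
        Ideal.span ((fun s => monomial s (1 : K)) '' nonstandardExps m a) := by
      refine Ideal.span_le.2 ?_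
      rintro _ ⟨g, hg, rfl⟩
      by_cases hg0 : g = 0
      · simp [hg0, MonomialOrder.leadingTerm]
      have hmem : m.degree g ∈ nonstandardExps m a := by
        by_contra hns
        have h := sum_smul_eq_zero_of_mem_toricIdeal hg
          fun s => if s = expSum a (m.degree g) then (1 : K) else 0
        rw [Finset.sum_eq_single_of_mem _ (m.degree_mem_support hg0)] at h
        · simp [hg0] at h
        · intro α hα hne
          rw [if_neg, smul_zero]
          intro he
          refine hns ⟨α, he, lt_of_le_of_ne (m.le_degree hα) ?_⟩
          exact fun h => hne (m.toSyn.injective h)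
      have : m.leadingTerm g =
          C (m.leadingCoeff g) * monomial (m.degree g) (1 : K) := by
        rw [MonomialOrder.leadingTerm, C_mul_monomial, mul_one]
      rw [this]
      exact Ideal.mul_mem_left _ _ (Ideal.subset_span ⟨_, hmem, rfl⟩)
    intro α hα
    obtain ⟨β, hβ, h⟩ := mem_ideal_span_monomial_image.1 (hle hf) α hα
    exact nonstandardExps_mono hβ h
  · intro h
    rw [f.as_sum]
    refine Ideal.sum_mem _ fun α hα => ?_
    have : monomial α (coeff α f) = C (coeff α f) * monomial α (1 : K) := by
      rw [C_mul_monomial, mul_one]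
    rw [this]
    exact Ideal.mul_mem_left _ _ (monomial_mem_initialIdeal (h α hα))

/-- After the monomials of `f` lying in the ideal are discarded, a power of the rest has as leading
exponent a multiple of a standard one. -/
theorem radical_initialIdeal_eq {m : MonomialOrder (Fin n)}
    (h : ∀ (k : ℕ) (α : Fin n →₀ ℕ), k • α ∈ nonstandardExps m a → α ∈ nonstandardExps m a) :
    (initialIdeal m (toricIdeal K a)).radical = initialIdeal m (toricIdeal K a) := by
  classical
  refine le_antisymm (fun f hf => ?_) Ideal.le_radical
  set J := initialIdeal m (toricIdeal K a)
  let g := ∑ α ∈ f.support with α ∉ nonstandardExps m a, monomial α (coeff α f)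
  let r := ∑ α ∈ f.support with α ∈ nonstandardExps m a, monomial α (coeff α f)
  have hr : r ∈ J := by
    refine Ideal.sum_mem _ fun α hα => ?_
    have : monomial α (coeff α f) = C (coeff α f) * monomial α (1 : K) := by
      rw [C_mul_monomial, mul_one]
    rw [this]
    exact Ideal.mul_mem_left _ _ (monomial_mem_initialIdeal (Finset.mem_filter.1 hα).2)
  have hfg : f = r + g := by
    conv_lhs => rw [f.as_sum]
    exact (Finset.sum_filter_add_sum_filter_not _ _ _).symm
  have hg : g ∈ J.radical := by
    have : g = f - r := by rw [hfg]; ring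
    rw [this]
    exact Ideal.sub_mem _ hf (Ideal.le_radical hr)
  have hg0 : g = 0 := by
    by_contra hg0
    obtain ⟨k, hk⟩ := hg
    have h1 : m.degree (g ^ k) ∈ (g ^ k).support := m.degree_mem_support (pow_ne_zero k hg0)
    have h2 := mem_initialIdeal_iff.1 hk _ h1
    rw [m.degree_pow] at h2
    have h3 := h _ _ h2
    have h4 := mem_support_iff.1 (m.degree_mem_support hg0)
    rw [coeff_sum] at h4
    obtain ⟨α, hα, h5⟩ := Finset.exists_ne_zero_of_sum_ne_zero h4
    rw [coeff_monomial] at h5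
    have h6 : α = m.degree g := by
      by_contra hc
      exact h5 (if_neg hc)
    rw [← h6] at h3
    exact (Finset.mem_filter.1 hα).2 h3
  rw [hfg, hg0, add_zero]
  exact hr

/-! ### Reverse lexicographic initial ideals -/

theorem revLex_lt_iff (ρ : Equiv.Perm (Fin n)) {α β : Fin n →₀ ℕ} (h : α.degree = β.degree) :
    (revLex ρ).toSyn β < (revLex ρ).toSyn α ↔
      ∃ i, (∀ j < i, β (ρ j) = α (ρ j)) ∧ α (ρ i) < β (ρ i) := by
  change RevLexSyn.ofExp ρ β < RevLexSyn.ofExp ρ α ↔ _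
  rw [RevLexSyn.lt_iff_key, RevLexSyn.key, RevLexSyn.key, Prod.Lex.toLex_lt_toLex]
  simp only [AddEquiv.symm_apply_apply, h, lt_irrefl, true_and, false_or]
  change (∃ i, (∀ j < i, -((β (ρ j) : ℕ) : ℤ) = -((α (ρ j) : ℕ) : ℤ)) ∧
    -((β (ρ i) : ℕ) : ℤ) < -((α (ρ i) : ℕ) : ℤ)) ↔ _
  simp

theorem revLex_lt_of_le (ρ : Equiv.Perm (Fin n)) {α β : Fin n →₀ ℕ} (h : α.degree = β.degree)
    {i : Fin n} (hle : ∀ j ≤ i, α (ρ j) ≤ β (ρ j)) (hlt : α (ρ i) < β (ρ i)) :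
    (revLex ρ).toSyn β < (revLex ρ).toSyn α := by
  rw [← not_le]
  intro hc
  rcases hc.lt_or_eq with hc | hc
  · rw [revLex_lt_iff ρ h.symm] at hc
    obtain ⟨k, hk1, hk2⟩ := hc
    rcases le_or_gt k i with hki | hki
    · exact absurd (hle k hki) (not_le.2 hk2)
    · exact hlt.ne (hk1 i hki)
  · exact hlt.ne (by rw [(revLex ρ).toSyn.injective hc])

theorem degree_eq_of_expSum_eq {D : ℕ} (hD : 0 < D) (hdeg : ∀ i, (a i).degree = D)
    {α β : Fin n →₀ ℕ} (h : expSum a α = expSum a β) : α.degree = β.degree := by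
  have h1 := congrArg Finsupp.degree h
  rw [QuadricConfig.deg_expSum (deg := Finsupp.degree) hdeg,
    QuadricConfig.deg_expSum (deg := Finsupp.degree) hdeg] at h1
  exact Nat.eq_of_mul_eq_mul_right hD h1

/-- If `β` beats `k • α` at the variable `ρ i`, cancelling the variables up to `ρ i` shows that `a
(ρ i)` divides the tail of `k • α`, hence also the tail of `α`. Rewriting that tail with a factor `ρ
i` gives a smaller exponent in the fiber of `α`. -/
theorem mem_nonstandardExps_of_nsmul (hq : QuadricConfig a) (hm : MidpointFree a) {D : ℕ}
    (hD : 0 < D) (hdeg : ∀ i, (a i).degree = D) (ρ : Equiv.Perm (Fin n)) (k : ℕ)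
    (α : Fin n →₀ ℕ) (h : k • α ∈ nonstandardExps (revLex ρ) a) :
    α ∈ nonstandardExps (revLex ρ) a := by
  classical
  obtain ⟨β, h1, h2⟩ := h
  rw [revLex_lt_iff ρ (degree_eq_of_expSum_eq hD hdeg h1.symm)] at h2
  obtain ⟨i, hi1, hi2⟩ := h2
  let lo : (Fin n →₀ ℕ) → (Fin n →₀ ℕ) := Finsupp.filter fun j => ρ.symm j ≤ i
  let hi : (Fin n →₀ ℕ) → (Fin n →₀ ℕ) := Finsupp.filter fun j => ¬ ρ.symm j ≤ i
  have hsplit : ∀ γ, lo γ + hi γ = γ := fun γ => Finsupp.filter_add_filter_not γ _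
  have hle : lo (k • α) + Finsupp.single (ρ i) 1 ≤ β := by
    intro l
    obtain ⟨j, rfl⟩ := ρ.surjective l
    simp only [lo, Finsupp.add_apply, Finsupp.filter_apply, Equiv.symm_apply_apply,
      Finsupp.single_apply, ρ.injective.eq_iff]
    rcases lt_trichotomy j i with hj | rfl | hj
    · simp [hj.le, hj.ne', hi1 j hj]
    · simpa using hi2
    · simp [hj.not_ge, hj.ne]
  obtain ⟨δ, hδ⟩ := exists_add_of_le hle
  have hd : GenDvd a (ρ i) (expSum a (hi (k • α))) := by
    refine ⟨δ, ?_⟩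
    have : expSum a (lo (k • α)) + expSum a (hi (k • α)) =
        expSum a (lo (k • α)) + (a (ρ i) + expSum a δ) := by
      rw [← map_add, hsplit, ← h1, hδ]
      simp [add_assoc]
    exact add_left_cancel this
  have hs : (hi (k • α)).support ⊆ (hi α).support := by
    intro l hl
    simp only [hi, Finsupp.support_filter, Finset.mem_filter, Finsupp.mem_support_iff,
      Finsupp.smul_apply, smul_eq_mul] at hl ⊢
    exact ⟨right_ne_zero_of_mul hl.1, hl.2⟩
  obtain ⟨ε, hε⟩ := hq.genDvd_of_support_subset hm hd hs
  have he : expSum a (lo α + (Finsupp.single (ρ i) 1 + ε)) = expSum a α := by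
    conv_rhs => rw [← hsplit α]
    rw [map_add, map_add, map_add, hε]
    simp
  refine ⟨_, he, revLex_lt_of_le ρ (degree_eq_of_expSum_eq hD hdeg he.symm) (i := i) ?_ ?_⟩
  · intro j hj
    simp [lo, hj]
  · simp [lo]

theorem isCompressedToric_of_midpointFree (hq : QuadricConfig a) (hm : MidpointFree a) {D : ℕ}
    (hD : 0 < D) (hdeg : ∀ i, (a i).degree = D) : IsCompressedToric K a := fun ρ =>
  radical_initialIdeal_eq fun k α h => mem_nonstandardExps_of_nsmul hq hm hD hdeg ρ k α h

theorem midpointFree_of_isCompressedToric (ha : Function.Injective a) {D : ℕ}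
    (hD : 0 < D) (hdeg : ∀ i, (a i).degree = D) (hc : IsCompressedToric K a) :
    MidpointFree a := by
  intro i j k h
  by_contra hj
  have : NeZero n := ⟨by rintro rfl; exact i.elim0⟩
  -- Making `x_j` the smallest variable puts `x_j x_k` below `x_i²`.
  let ρ : Equiv.Perm (Fin n) := Equiv.swap 0 j
  have hρ : ρ 0 = j := Equiv.swap_apply_left 0 j
  have hfib : expSum a (Finsupp.single j 1 + Finsupp.single k 1) =
      expSum a (2 • Finsupp.single i 1) := by
    simp [← h, two_smul]
  have h2 : 2 • Finsupp.single i 1 ∈ nonstandardExps (revLex ρ) a := by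
    refine ⟨_, hfib, ?_⟩
    rw [revLex_lt_iff ρ (degree_eq_of_expSum_eq hD hdeg hfib.symm)]
    refine ⟨0, fun l hl => absurd hl (Fin.not_lt_zero l), ?_⟩
    rw [hρ]
    simp [Finsupp.single_apply, Ne.symm hj]
  have h3 : (X i : MvPolynomial (Fin n) K) ∈ initialIdeal (revLex ρ) (toricIdeal K a) := by
    rw [← hc ρ]
    refine ⟨2, ?_⟩
    have := monomial_mem_initialIdeal (K := K) h2
    rwa [← one_pow (M := K) 2, ← monomial_pow] at this
  obtain ⟨β, hβ, hlt⟩ := mem_initialIdeal_iff.1 h3 (Finsupp.single i 1) (by simp [X])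
  have h4 := degree_eq_of_expSum_eq hD hdeg hβ
  rw [Finsupp.degree_single] at h4
  obtain ⟨l, rfl⟩ := Finsupp.exists_eq_single_of_degree_eq_one h4
  rw [expSum_single, expSum_single, one_smul, one_smul] at hβ
  rw [ha hβ] at hlt
  exact lt_irrefl _ hlt

end InitialIdeal

/-! ### Products of multilinear polynomials -/

theorem MvPolynomial.squarefree_of_degreeOf_le_one {σ K : Type*} [Field K] {G : MvPolynomial σ K}
    (hG : G ≠ 0) (h : ∀ l, degreeOf l G ≤ 1) : Squarefree G := by
  rintro x ⟨w, rfl⟩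
  have hw : w ≠ 0 := right_ne_zero_of_mul hG
  have hx : x ≠ 0 := left_ne_zero_of_mul (left_ne_zero_of_mul hG)
  have h0 : ∀ l, degreeOf l x = 0 := by
    intro l
    have := h l
    rw [degreeOf_mul_eq (mul_ne_zero hx hx) hw, degreeOf_mul_eq hx hx] at this
    omega
  have h1 : x.totalDegree = 0 := by
    rw [totalDegree_eq_zero_iff]
    intro m hm l
    have := monomial_le_degreeOf l hm
    rw [h0] at this
    omega
  rw [totalDegree_eq_zero_iff_eq_C] at h1
  rw [h1] at hx ⊢
  exact (isUnit_iff_ne_zero.2 (by simpa using hx)).map C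

/-- `G` is squarefree and divides `F²`, so `F = G w`. Cancelling leaves `H = w² G`, and
squarefreeness of `H` makes `w` constant. -/
theorem MvPolynomial.exists_eq_smul_of_mul_self_eq_mul {σ K : Type*} [Field K]
    {F G H : MvPolynomial σ K} (hG : G ≠ 0) (hH : H ≠ 0) (hG1 : ∀ l, degreeOf l G ≤ 1)
    (hH1 : ∀ l, degreeOf l H ≤ 1) (h : F * F = G * H) : ∃ c : K, F = c • G := by
  have hsG := squarefree_of_degreeOf_le_one hG hG1
  have hsH := squarefree_of_degreeOf_le_one hH hH1
  obtain ⟨w, rfl⟩ : G ∣ F := by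
    rw [← hsG.dvd_pow_iff_dvd two_ne_zero, sq, h]
    exact dvd_mul_right _ _
  have hw : H = w * w * G := by
    apply mul_left_cancel₀ hG
    rw [← h]
    ring
  have hu : IsUnit w := hsH w ⟨G, hw⟩
  rw [MvPolynomial.isUnit_iff_eq_C_of_isReduced] at hu
  obtain ⟨c, _, rfl⟩ := hu
  exact ⟨c, by rw [smul_eq_C_mul, mul_comm]⟩

/-! ### Tangent spaces of toric rings -/

section PointDerivation

variable {K R : Type*} [Field K] [CommRing R] [Algebra K R]

/-- The tangent space at a rational point. -/
def pointDer (ε : R →ₐ[K] K) : Submodule K (R →ₗ[K] K) where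
  carrier := {δ | ∀ x y, δ (x * y) = ε x * δ y + ε y * δ x}
  add_mem' {δ δ'} h h' x y := by
    rw [LinearMap.add_apply, h, h', LinearMap.add_apply, LinearMap.add_apply]
    ring
  zero_mem' x y := by simp
  smul_mem' c δ h x y := by
    simp only [LinearMap.smul_apply, h x y, smul_eq_mul]
    ring

theorem pointDer_one {ε : R →ₐ[K] K} {δ : R →ₗ[K] K} (h : δ ∈ pointDer ε) : δ 1 = 0 := by
  have := h 1 1
  simpa using this

theorem comp_mem_pointDer {R' : Type*} [CommRing R'] [Algebra K R'] {ε : R →ₐ[K] K}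
    {δ : R →ₗ[K] K} (h : δ ∈ pointDer ε) (φ : R' →ₐ[K] R) :
    δ ∘ₗ φ.toLinearMap ∈ pointDer (ε.comp φ) := by
  intro x y
  simpa using h (φ x) (φ y)

end PointDerivation

section Irreducible

variable {K : Type*} [Field K] {n d : ℕ} {a : Fin n → Fin d →₀ ℕ}

/-- The irreducible elements of the monoid generated by `a`. -/
def irrExps (a : Fin n → Fin d →₀ ℕ) : Set (Fin d →₀ ℕ) :=
  {s | s ≠ 0 ∧ (∃ α, s = expSum a α) ∧
    ∀ α β, s = expSum a α + expSum a β → expSum a α = 0 ∨ expSum a β = 0}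

theorem irrExps_subset_range (a : Fin n → Fin d →₀ ℕ) : irrExps a ⊆ Set.range a := by
  rintro s hs
  obtain ⟨α, rfl⟩ := hs.2.1
  induction α using Finsupp.induction_single_one with
  | zero => exact absurd (map_zero _) hs.1
  | step i α ih =>
    rw [map_add] at hs ⊢
    rcases hs.2.2 _ _ rfl with h | h
    · exact ⟨i, by simp [h]⟩
    · rw [h, add_zero] at hs ⊢
      exact ih hs

instance (a : Fin n → Fin d →₀ ℕ) : Finite (irrExps a) :=
  (Set.finite_range a).subset (irrExps_subset_range a)

theorem mem_irrExps {D : ℕ} (hD : 0 < D) (hdeg : ∀ i, (a i).degree = D) (i : Fin n) :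
    a i ∈ irrExps a := by
  refine ⟨?_, ⟨Finsupp.single i 1, by simp⟩, fun α β h => ?_⟩
  · intro h
    have := hdeg i
    rw [h, map_zero] at this
    omega
  · have h1 : expSum a (Finsupp.single i 1) = expSum a (α + β) := by simpa using h
    have h2 := degree_eq_of_expSum_eq hD hdeg h1
    rw [map_add, Finsupp.degree_single] at h2
    rcases (by omega : α.degree = 0 ∨ β.degree = 0) with h3 | h3
    · left; rw [(Finsupp.degree_eq_zero_iff α).1 h3, map_zero]
    · right; rw [(Finsupp.degree_eq_zero_iff β).1 h3, map_zero]

/-- The monomial attached to an irreducible exponent. -/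
noncomputable def irrMon (K : Type*) [Field K] (a : Fin n → Fin d →₀ ℕ) (s : irrExps a) :
    toricRing K a :=
  toricMon K a s.2.2.1.choose

@[simp]
theorem coe_irrMon (s : irrExps a) :
    (irrMon K a s : MvPolynomial (Fin d) K) = monomial s.1 1 := by
  rw [irrMon, coe_toricMon, ← s.2.2.1.choose_spec]

/-- The rational point at which all monomials except `1` vanish. -/
noncomputable def toricAug (K : Type*) [Field K] (a : Fin n → Fin d →₀ ℕ) :
    toricRing K a →ₐ[K] K :=
  (aeval (0 : Fin d → K)).comp (toricRing K a).val

theorem toricAug_apply (x : toricRing K a) :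
    toricAug K a x = coeff 0 (x : MvPolynomial (Fin d) K) := by
  simp [toricAug, constantCoeff_eq]

/-- The coefficient of a monomial as a linear form on the toric ring. -/
noncomputable def toricCoeff (K : Type*) [Field K] (a : Fin n → Fin d →₀ ℕ) (s : Fin d →₀ ℕ) :
    toricRing K a →ₗ[K] K :=
  lcoeff K s ∘ₗ (toricRing K a).val.toLinearMap

@[simp]
theorem toricCoeff_apply (s : Fin d →₀ ℕ) (x : toricRing K a) :
    toricCoeff K a s x = coeff s (x : MvPolynomial (Fin d) K) := rfl

/-- An irreducible exponent splits only trivially, so just the two Leibniz terms survive. -/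
theorem toricCoeff_mem_pointDer {s : Fin d →₀ ℕ} (hs : s ∈ irrExps a) :
    toricCoeff K a s ∈ pointDer (toricAug K a) := by
  classical
  intro x y
  rw [toricAug_apply, toricAug_apply, toricCoeff_apply, toricCoeff_apply, toricCoeff_apply,
    MulMemClass.coe_mul, coeff_mul,
    Finset.sum_eq_add (0, s) (s, 0) (by simp [hs.1, Ne.symm hs.1])]
  · simp only; ring
  · rintro ⟨p, q⟩ hpq ⟨h1, h2⟩
    rw [Finset.HasAntidiagonal.mem_antidiagonal] at hpq
    by_contra hne
    obtain ⟨α, hα⟩ := exists_expSum_of_coeff_ne_zero x (left_ne_zero_of_mul hne)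
    obtain ⟨β, hβ⟩ := exists_expSum_of_coeff_ne_zero y (right_ne_zero_of_mul hne)
    simp only at hα hβ hpq
    rcases hs.2.2 α β (by rw [← hpq, hα, hβ]) with h | h
    · rw [← hα] at h
      subst h
      exact h1 (by rw [← hpq, zero_add])
    · rw [← hβ] at h
      subst h
      exact h2 (by rw [← hpq, add_zero])
  · intro h; simp at h
  · intro h; simp at h

theorem toricMon_add (α β : Fin n →₀ ℕ) :
    toricMon K a (α + β) = toricMon K a α * toricMon K a β := by
  apply Subtype.ext
  simp [monomial_mul]

theorem pointDer_eq_zero {ε : toricRing K a →ₐ[K] K} {δ : toricRing K a →ₗ[K] K}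
    (hδ : δ ∈ pointDer ε) (h : ∀ s, δ (irrMon K a s) = 0) : δ = 0 := by
  have hmon : ∀ (N : ℕ) (α : Fin n →₀ ℕ), (expSum a α).degree ≤ N → δ (toricMon K a α) = 0 := by
    intro N
    induction N with
    | zero =>
      intro α hα
      have h0 : expSum a α = expSum a 0 := by
        rw [map_zero]
        exact (Finsupp.degree_eq_zero_iff _).1 (Nat.le_zero.1 hα)
      rw [toricMon_congr h0]
      have : toricMon K a 0 = 1 := by apply Subtype.ext; simp
      rw [this, pointDer_one hδ]
    | succ N ih =>
      intro α hα
      by_cases h0 : expSum a α = 0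
      · exact ih α (by simp [h0])
      by_cases hirr : expSum a α ∈ irrExps a
      · have : toricMon K a α = irrMon K a ⟨_, hirr⟩ := by apply Subtype.ext; simp
        rw [this, h]
      · have : ∃ β γ, expSum a α = expSum a β + expSum a γ ∧ expSum a β ≠ 0 ∧
            expSum a γ ≠ 0 := by
          by_contra hc
          push Not at hc
          exact hirr ⟨h0, ⟨α, rfl⟩, fun β γ hβγ => or_iff_not_imp_left.2 (hc β γ hβγ)⟩
        obtain ⟨β, γ, he, hβ, hγ⟩ := this
        have hdeg := congrArg Finsupp.degree he
        rw [map_add] at hdeg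
        have hβ' : (expSum a β).degree ≠ 0 := fun h => hβ ((Finsupp.degree_eq_zero_iff _).1 h)
        have hγ' : (expSum a γ).degree ≠ 0 := fun h => hγ ((Finsupp.degree_eq_zero_iff _).1 h)
        rw [toricMon_congr (he.trans (map_add _ _ _).symm), toricMon_add, hδ,
          ih β (by omega), ih γ (by omega), mul_zero, mul_zero, add_zero]
  ext x
  obtain ⟨f, rfl⟩ := aeval_toricGen_surjective x
  rw [f.as_sum, map_sum, map_sum, LinearMap.zero_apply]
  refine Finset.sum_eq_zero fun α _ => ?_
  have : monomial α (coeff α f) = coeff α f • monomial α (1 : K) := by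
    rw [smul_monomial, smul_eq_mul, mul_one]
  rw [this, map_smul, map_smul]
  have := hmon _ α le_rfl
  rw [toricMon] at this
  rw [this, smul_zero]

theorem pointDer_eq_zero_of_toricGen {ε : toricRing K a →ₐ[K] K} {δ : toricRing K a →ₗ[K] K}
    (hδ : δ ∈ pointDer ε) (h : ∀ i, δ (toricGen K a i) = 0) : δ = 0 := by
  refine pointDer_eq_zero hδ fun s => ?_
  obtain ⟨i, hi⟩ := irrExps_subset_range a s.2
  rw [← h i]
  congr 1
  apply Subtype.ext
  simp [hi]

/-! ### Cotangent spaces under an isomorphism -/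

section Equiv

variable {p e : ℕ} {b : Fin p → Fin e →₀ ℕ}

/-- The matrix of the cotangent map at the monomial points. -/
noncomputable def cotangentMatrix (φ : toricRing K a →ₐ[K] toricRing K b) :
    Matrix (irrExps b) (irrExps a) K :=
  .of fun s t => coeff s.1 (φ (irrMon K a t) : MvPolynomial (Fin e) K)

theorem sum_smul_toricCoeff_comp [Fintype (irrExps b)] (φ : toricRing K a →ₐ[K] toricRing K b)
    (z : irrExps b → K) :
    (∑ s, z s • toricCoeff K b s.1) ∘ₗ φ.toLinearMap ∈ pointDer ((toricAug K b).comp φ) :=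
  comp_mem_pointDer (Submodule.sum_mem _ fun s _ =>
    Submodule.smul_mem _ _ (toricCoeff_mem_pointDer s.2)) φ

theorem vecMul_cotangentMatrix_injective [Fintype (irrExps b)]
    (φ : toricRing K a ≃ₐ[K] toricRing K b) :
    Function.Injective fun z => Matrix.vecMul z (cotangentMatrix (φ : toricRing K a →ₐ[K] toricRing K b)) := by
  classical
  have hinj : ∀ z, Matrix.vecMul z (cotangentMatrix (φ : toricRing K a →ₐ[K] toricRing K b)) = 0 → z = 0 := by
    intro z hz
    have h0 := pointDer_eq_zero (sum_smul_toricCoeff_comp (φ : toricRing K a →ₐ[K] toricRing K b) z) fun t => by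
      have := congrFun hz t
      simpa [Matrix.vecMul, dotProduct, cotangentMatrix] using this
    ext s
    have h1 := LinearMap.congr_fun h0 (φ.symm (irrMon K b s))
    simpa [coeff_monomial, Subtype.coe_inj] using h1
  intro z z' h
  rw [← sub_eq_zero]
  apply hinj
  rw [Matrix.sub_vecMul]
  exact sub_eq_zero.2 h

/-- Row injectivity for `φ` and for its inverse shows that the matrix is square, hence invertible,
even if `φ` does not match the origins. -/
theorem mulVec_cotangentMatrix_eq_zero [Fintype (irrExps a)] [Fintype (irrExps b)]
    (φ : toricRing K a ≃ₐ[K] toricRing K b) {y : irrExps a → K}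
    (hy : Matrix.mulVec (cotangentMatrix (φ : toricRing K a →ₐ[K] toricRing K b)) y = 0) : y = 0 := by
  classical
  have h1 : Function.Injective
      (cotangentMatrix (φ : toricRing K a →ₐ[K] toricRing K b)).vecMulLinear :=
    vecMul_cotangentMatrix_injective φ
  have h2 : Function.Injective
      (cotangentMatrix (φ.symm : toricRing K b →ₐ[K] toricRing K a)).vecMulLinear :=
    vecMul_cotangentMatrix_injective φ.symm
  have h3 : Module.finrank K (irrExps b → K) = Module.finrank K (irrExps a → K) :=
    le_antisymm (LinearMap.finrank_le_finrank_of_injective h1)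
      (LinearMap.finrank_le_finrank_of_injective h2)
  have h4 := (LinearMap.injective_iff_surjective_of_finrank_eq_finrank h3).1 h1
  ext t
  obtain ⟨z, hz⟩ := h4 (Pi.single t 1)
  rw [Matrix.vecMulLinear_apply] at hz
  have := Matrix.dotProduct_mulVec z (cotangentMatrix (φ : toricRing K a →ₐ[K] toricRing K b)) y
  rw [hy, hz] at this
  simpa using this.symm

theorem eq_zero_of_sum_coeff_eq_zero (ha : Function.Injective a) {D : ℕ} (hD : 0 < D)
    (hdeg : ∀ i, (a i).degree = D) (φ : toricRing K a ≃ₐ[K] toricRing K b) {y : Fin n → K}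
    (hy : ∀ s ∈ irrExps b,
      ∑ i, y i * coeff s (φ (toricGen K a i) : MvPolynomial (Fin e) K) = 0) : y = 0 := by
  classical
  have := Fintype.ofFinite (irrExps a)
  have := Fintype.ofFinite (irrExps b)
  let E : Fin n ≃ irrExps a := Equiv.ofBijective (fun i => ⟨a i, mem_irrExps hD hdeg i⟩)
    ⟨fun i j h => ha (congrArg Subtype.val h), fun s => by
      obtain ⟨i, hi⟩ := irrExps_subset_range a s.2
      exact ⟨i, Subtype.ext hi⟩⟩
  have hE : ∀ i, irrMon K a (E i) = toricGen K a i := fun i => by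
    apply Subtype.ext
    rw [coe_irrMon]
    rfl
  have h0 : y ∘ E.symm = 0 := by
    apply mulVec_cotangentMatrix_eq_zero φ
    ext s
    rw [Matrix.mulVec, dotProduct, ← E.sum_comp, Pi.zero_apply, ← hy s.1 s.2]
    refine Finset.sum_congr rfl fun i _ => ?_
    simp [cotangentMatrix, hE, mul_comm]
  ext i
  simpa using congrFun h0 (E i)

end Equiv

end Irreducible

/-! ### Free generators and translations -/

/-- The generator `a i` occurs in no nontrivial quadratic relation. -/
def IsFreeGen {ι M : Type*} [Add M] (a : ι → M) (i : ι) : Prop :=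
  ∀ j k l, a i + a k = a j + a l → j = i ∨ l = i

namespace QuadricConfig

variable {ι M : Type*} [AddCommMonoid M] {a : ι → M}

theorem mem_support_of_isFreeGen (hq : QuadricConfig a) {i : ι} (hi : IsFreeGen a i)
    {β : ι →₀ ℕ} (h : GenDvd a i (expSum a β)) : i ∈ β.support := by
  induction β using Finsupp.induction_single_one with
  | zero => exact absurd (by simpa using h) (hq.not_genDvd_zero i)
  | step j β ih =>
    by_cases hij : i = j
    · subst hij; simp
    · obtain ⟨k, l, hk, hl⟩ := hq.colon i j β hij (by simpa using h)
      rcases hi k l j hl.symm with rfl | rfl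
      · have := ih hk
        rw [Finsupp.mem_support_iff] at this ⊢
        rw [Finsupp.add_apply]
        omega
      · exact absurd rfl hij

theorem apply_eq_of_isFreeGen [IsCancelAdd M] (hq : QuadricConfig a) {i : ι} (hi : IsFreeGen a i)
    {α β : ι →₀ ℕ} (h : expSum a α = expSum a β) : α i = β i := by
  have hle : ∀ (N : ℕ) (α β : ι →₀ ℕ), expSum a α = expSum a β → N ≤ α i → N ≤ β i := by
    intro N
    induction N with
    | zero => intros; exact Nat.zero_le _
    | succ N ih =>
      have hsub : ∀ γ : ι →₀ ℕ, γ i ≠ 0 → ∃ δ, γ = Finsupp.single i 1 + δ := fun γ hγ =>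
        exists_add_of_le (by
          rw [Finsupp.single_le_iff]
          exact Nat.one_le_iff_ne_zero.2 hγ)
      intro α β h hN
      have hi1 : i ∈ α.support := by rw [Finsupp.mem_support_iff]; omega
      have hi2 := hq.mem_support_of_isFreeGen hi (h ▸ genDvd_of_mem_support a hi1)
      obtain ⟨α, rfl⟩ := hsub α (Finsupp.mem_support_iff.1 hi1)
      obtain ⟨β, rfl⟩ := hsub β (Finsupp.mem_support_iff.1 hi2)
      rw [map_add, map_add] at h
      have := ih α β (add_left_cancel h)
      simp only [Finsupp.add_apply, Finsupp.single_eq_same] at hN ⊢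
      omega
  exact le_antisymm (hle _ α β h le_rfl) (hle _ β α h.symm le_rfl)

end QuadricConfig

section Translation

variable {K : Type*} [Field K] {n d : ℕ} {a : Fin n → Fin d →₀ ℕ}

/-- The exponent of a free generator is constant on fibers, so free generators behave as polynomial
variables and may be shifted. -/
theorem exists_translation (hq : QuadricConfig a) {c : Fin n → K}
    (hc : ∀ i, c i ≠ 0 → IsFreeGen a i) :
    ∃ τ : toricRing K a →ₐ[K] toricRing K a,
      ∀ i, τ (toricGen K a i) = toricGen K a i + algebraMap K _ (c i) := by
  classical
  refine exists_toricRing_lift _ fun α β h => ?_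
  have hsplit : ∀ γ : Fin n →₀ ℕ,
      γ.filter (fun i => c i = 0) + γ.filter (fun i => ¬ c i = 0) = γ :=
    fun γ => Finsupp.filter_add_filter_not γ _
  have hfree : α.filter (fun i => ¬ c i = 0) = β.filter (fun i => ¬ c i = 0) := by
    ext i
    rw [Finsupp.filter_apply, Finsupp.filter_apply]
    split_ifs with hi
    · rfl
    · exact hq.apply_eq_of_isFreeGen (hc i hi) h
  have hrest : expSum a (α.filter fun i => c i = 0) = expSum a (β.filter fun i => c i = 0) := by
    rw [← hsplit α, ← hsplit β, map_add, map_add, ← hfree] at h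
    exact add_right_cancel h
  have hprod : ∀ γ : Fin n →₀ ℕ,
      (γ.prod fun i e => (toricGen K a i + algebraMap K (toricRing K a) (c i)) ^ e) =
        toricMon K a (γ.filter fun i => c i = 0) * (γ.filter fun i => ¬ c i = 0).prod
          fun i e => (toricGen K a i + algebraMap K (toricRing K a) (c i)) ^ e := by
    intro γ
    conv_lhs => rw [← hsplit γ]
    rw [Finsupp.prod_add_index' (by simp) (by intros; rw [pow_add]), ← prod_toricGen_pow]
    congr 1
    refine Finset.prod_congr rfl fun i hi => ?_
    rw [Finsupp.support_filter, Finset.mem_filter] at hi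
    simp only [hi.2, map_zero, add_zero]
  rw [hprod α, hprod β, hfree, toricMon_congr hrest]

theorem exists_translation_equiv (hq : QuadricConfig a) {c : Fin n → K}
    (hc : ∀ i, c i ≠ 0 → IsFreeGen a i) :
    ∃ τ : toricRing K a ≃ₐ[K] toricRing K a,
      ∀ i, τ (toricGen K a i) = toricGen K a i - algebraMap K _ (c i) := by
  obtain ⟨τ, hτ⟩ := exists_translation hq (c := -c) fun i hi => hc i (by simpa using hi)
  obtain ⟨τ', hτ'⟩ := exists_translation hq hc
  refine ⟨AlgEquiv.ofAlgHom τ τ' ?_ ?_, fun i => ?_⟩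
  · exact toricRing_algHom_ext fun i => by simp [hτ, hτ']
  · exact toricRing_algHom_ext fun i => by simp [hτ, hτ']
  · simp [hτ, sub_eq_add_neg]

variable {p e : ℕ} {b : Fin p → Fin e →₀ ℕ}

/-- Differentiating `u_i u_k = u_j u_l` at the pulled-back origin gives `c_i du_k + c_k du_i = c_j
du_l + c_l du_j`. The differentials are independent there, so a nontrivial relation forces `c_i =
0`. -/
theorem isFreeGen_of_toricAug_ne_zero (ha : Function.Injective a) {D : ℕ} (hD : 0 < D)
    (hdeg : ∀ i, (a i).degree = D) (φ : toricRing K a ≃ₐ[K] toricRing K b) {i : Fin n}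
    (hi : toricAug K b (φ (toricGen K a i)) ≠ 0) : IsFreeGen a i := by
  classical
  intro j k l h
  by_contra! hne
  obtain ⟨hji, hli⟩ := hne
  set c : Fin n → K := fun i => toricAug K b (φ (toricGen K a i)) with hcdef
  have hkj : k ≠ j := by
    rintro rfl
    rw [add_comm (a k)] at h
    exact hli (ha (add_right_cancel h)).symm
  have hkl : k ≠ l := by
    rintro rfl
    exact hji (ha (add_right_cancel h)).symm
  have hmul : toricGen K a i * toricGen K a k = toricGen K a j * toricGen K a l := by
    apply Subtype.ext
    simp [monomial_mul, h]
  have hcc : c i * c k = c j * c l := by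
    simp only [hcdef, ← map_mul, hmul]
  have hy : c i • Pi.single k 1 + c k • Pi.single i 1 -
      (c j • Pi.single l 1 + c l • Pi.single j 1) = (0 : Fin n → K) := by
    refine eq_zero_of_sum_coeff_eq_zero ha hD hdeg φ fun s hs => ?_
    have h1 := congrArg (fun x => toricCoeff K b s (φ x)) hmul
    simp only [map_mul] at h1
    rw [toricCoeff_mem_pointDer hs, toricCoeff_mem_pointDer hs] at h1
    simp only [toricCoeff_apply] at h1
    have h2 : ∀ (x : K) (m : Fin n),
        ∑ i, (x • Pi.single m (1 : K) : Fin n → K) i *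
          coeff s (φ (toricGen K a i) : MvPolynomial (Fin e) K) =
        x * coeff s (φ (toricGen K a m) : MvPolynomial (Fin e) K) := by
      intro x m
      simp [Pi.single_apply]
    simp only [Pi.sub_apply, Pi.add_apply, sub_mul, add_mul, Finset.sum_sub_distrib,
      Finset.sum_add_distrib, h2]
    rw [sub_eq_zero]
    exact h1
  by_cases hki : k = i
  -- The coefficient of `du_i` is `2 c_i`, useless in characteristic 2; that of `du_l` gives `c_j =
  -- 0`, hence `c_i² = 0`.
  · subst hki
    have hjl : j ≠ l := by
      rintro rfl
      apply hji
      apply ha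
      ext x
      have := DFunLike.congr_fun h x
      simp only [Finsupp.add_apply] at this
      omega
    have h1 := congrFun hy l
    simp [hkl.symm, hjl.symm] at h1
    rw [h1, zero_mul, mul_self_eq_zero] at hcc
    exact hi hcc
  · have h1 := congrFun hy k
    simp [hki, hkl, hkj] at h1
    exact hi h1

/-- An isomorphic toric ring is isomorphic by an isomorphism preserving the monomial points. -/
theorem exists_augmented_equiv (hq : QuadricConfig a) {D : ℕ} (hD : 0 < D)
    (hdeg : ∀ i, (a i).degree = D) (φ : toricRing K a ≃ₐ[K] toricRing K b) :
    ∃ ψ : toricRing K a ≃ₐ[K] toricRing K b, (toricAug K b).comp (ψ : toricRing K a →ₐ[K] _) =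
      toricAug K a := by
  obtain ⟨τ, hτ⟩ := exists_translation_equiv hq
    (c := fun i => toricAug K b (φ (toricGen K a i)))
    fun i hi => isFreeGen_of_toricAug_ne_zero hq.inj hD hdeg φ hi
  refine ⟨τ.trans φ, toricRing_algHom_ext fun i => ?_⟩
  have h0 : a i ≠ 0 := (mem_irrExps hD hdeg i).1
  simp [hτ, toricAug_apply (a := a), coeff_monomial, h0]

end Translation

/-! ### Linear parts -/

section LinearPart

variable {K : Type*} [Field K] {n d p e : ℕ} {a : Fin n → Fin d →₀ ℕ} {b : Fin p → Fin e →₀ ℕ}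

/-- The order of vanishing of a monomial of `K[b]`, pulled back to `K[a]`. -/
noncomputable def monOrder (χ : toricRing K b →ₐ[K] toricRing K a) (α : Fin p →₀ ℕ) : ℕ∞ :=
  MvPowerSeries.order ((χ (toricMon K b α) : MvPolynomial (Fin d) K) : MvPowerSeries (Fin d) K)

theorem monOrder_add (χ : toricRing K b →ₐ[K] toricRing K a) {α β γ : Fin p →₀ ℕ}
    (h : expSum b γ = expSum b α + expSum b β) :
    monOrder χ γ = monOrder χ α + monOrder χ β := by
  rw [← map_add] at h
  rw [monOrder, toricMon_congr h, toricMon_add, map_mul, MulMemClass.coe_mul,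
    MvPolynomial.coe_mul, MvPowerSeries.order_mul]
  rfl

theorem le_monOrder {D : ℕ} (hdeg : ∀ i, (a i).degree = D)
    {χ : toricRing K b →ₐ[K] toricRing K a} (hχ : (toricAug K a).comp χ = toricAug K b)
    {α : Fin p →₀ ℕ} (hα : expSum b α ≠ 0) : (D : ℕ∞) ≤ monOrder χ α := by
  refine MvPowerSeries.nat_le_order fun s hs => ?_
  rw [MvPolynomial.coeff_coe]
  by_contra hne
  obtain ⟨γ, rfl⟩ := exists_expSum_of_coeff_ne_zero _ hne
  rw [QuadricConfig.deg_expSum (deg := Finsupp.degree) hdeg] at hs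
  have h0 : γ.degree = 0 := by
    by_contra h0
    exact absurd hs (not_lt.2 (Nat.le_mul_of_pos_left D (Nat.pos_of_ne_zero h0)))
  rw [(Finsupp.degree_eq_zero_iff γ).1 h0, map_zero, ← toricAug_apply] at hne
  have h1 := DFunLike.congr_fun hχ (toricMon K b α)
  rw [AlgHom.comp_apply] at h1
  rw [h1, toricAug_apply, coe_toricMon, coeff_monomial, if_neg hα] at hne
  exact hne rfl

/-- The coefficient form of an irreducible monomial pulls back to a tangent vector at the origin of
`K[a]`, a combination of the coefficient forms at the `a i`. It equals 1 on the preimage of the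
monomial, which therefore has a term of degree `D`. -/
theorem monOrder_eq_of_mem_irrExps {D : ℕ} (hD : 0 < D) (hdeg : ∀ i, (a i).degree = D)
    (ha : Function.Injective a) {ψ : toricRing K a ≃ₐ[K] toricRing K b}
    (hψ : (toricAug K b).comp (ψ : toricRing K a →ₐ[K] _) = toricAug K a)
    (hχ : (toricAug K a).comp (ψ.symm : toricRing K b →ₐ[K] _) = toricAug K b)
    {α : Fin p →₀ ℕ} (hα : expSum b α ∈ irrExps b) :
    monOrder (ψ.symm : toricRing K b →ₐ[K] toricRing K a) α = D := by
  classical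
  refine le_antisymm ?_ (le_monOrder hdeg hχ hα.1)
  let δ : toricRing K a →ₗ[K] K :=
    toricCoeff K b (expSum b α) ∘ₗ (ψ : toricRing K a →ₐ[K] toricRing K b).toLinearMap
  have hδ : δ ∈ pointDer (toricAug K a) := by
    rw [← hψ]
    exact comp_mem_pointDer (toricCoeff_mem_pointDer hα) _
  have hsum : δ = ∑ i, δ (toricGen K a i) • toricCoeff K a (a i) := by
    rw [← sub_eq_zero]
    refine pointDer_eq_zero_of_toricGen (ε := toricAug K a) (Submodule.sub_mem _ hδ
      (Submodule.sum_mem _ fun i _ => Submodule.smul_mem _ _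
        (toricCoeff_mem_pointDer (mem_irrExps hD hdeg i)))) fun j => ?_
    simp [coeff_monomial, ha.eq_iff]
  have h1 := LinearMap.congr_fun hsum (ψ.symm (toricMon K b α))
  have h2 : δ (ψ.symm (toricMon K b α)) = 1 := by simp [δ]
  rw [h2, LinearMap.sum_apply] at h1
  obtain ⟨i, _, hi⟩ := Finset.exists_ne_zero_of_sum_ne_zero (h1 ▸ one_ne_zero)
  rw [LinearMap.smul_apply, toricCoeff_apply] at hi
  have h3 := right_ne_zero_of_smul hi
  rw [← MvPolynomial.coeff_coe] at h3
  have h4 := MvPowerSeries.order_le h3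
  rw [hdeg] at h4
  exact h4

/-- The part of an element of a toric ring consisting of its irreducible monomials. -/
noncomputable def linPart (x : toricRing K b) : MvPolynomial (Fin e) K :=
  ∑ s ∈ (Set.toFinite (irrExps b)).toFinset,
    monomial s (coeff s (x : MvPolynomial (Fin e) K))

open scoped Classical in
theorem coeff_linPart (x : toricRing K b) (s : Fin e →₀ ℕ) :
    coeff s (linPart x) =
      if s ∈ irrExps b then coeff s (x : MvPolynomial (Fin e) K) else 0 := by
  simp [linPart, coeff_sum, coeff_monomial]

theorem degreeOf_linPart_le (hb : ∀ i l, b i l ≤ 1) (x : toricRing K b) (l : Fin e) :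
    degreeOf l (linPart x) ≤ 1 := by
  classical
  rw [degreeOf_le_iff]
  intro s hs
  rw [mem_support_iff, coeff_linPart] at hs
  have hs' : s ∈ irrExps b := by
    by_contra hc
    exact hs (if_neg hc)
  obtain ⟨i, rfl⟩ := irrExps_subset_range b hs'
  exact hb i l

-- `o` replaces a grading on `K[b]`. Decomposable monomials have order at least `2 * D`, so one of
-- order `2 * D` splits nontrivially only into two irreducibles; vanishing constant terms exclude
-- trivial splittings.
open scoped Classical in
theorem coeff_linPart_mul_linPart {D : ℕ} (hD : 0 < D) {o : (Fin p →₀ ℕ) → ℕ∞}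
    (hadd : ∀ α β γ, expSum b γ = expSum b α + expSum b β → o γ = o α + o β)
    (hle : ∀ α, expSum b α ≠ 0 → (D : ℕ∞) ≤ o α)
    (hirr : ∀ α, expSum b α ∈ irrExps b → o α = D) {x y : toricRing K b}
    (hx : toricAug K b x = 0) (hy : toricAug K b y = 0) (s : Fin e →₀ ℕ) :
    coeff s (linPart x * linPart y) =
      if ∃ γ, s = expSum b γ ∧ o γ = (2 * D : ℕ) then
        coeff s ((x * y : toricRing K b) : MvPolynomial (Fin e) K) else 0 := by
  have hnirr : ∀ α, expSum b α ≠ 0 → expSum b α ∉ irrExps b → ((2 * D : ℕ) : ℕ∞) ≤ o α := by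
    intro α h0 hα
    have : ∃ β γ, expSum b α = expSum b β + expSum b γ ∧ expSum b β ≠ 0 ∧ expSum b γ ≠ 0 := by
      by_contra hc
      push Not at hc
      exact hα ⟨h0, ⟨α, rfl⟩, fun β γ hβγ => or_iff_not_imp_left.2 (hc β γ hβγ)⟩
    obtain ⟨β, γ, he, hβ, hγ⟩ := this
    rw [hadd _ _ _ he, two_mul, Nat.cast_add]
    exact add_le_add (hle β hβ) (hle γ hγ)
  rw [toricAug_apply] at hx hy
  split_ifs with hs
  · obtain ⟨γ, rfl, hγ⟩ := hs
    rw [MulMemClass.coe_mul, coeff_mul, coeff_mul]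
    refine Finset.sum_congr rfl ?_
    rintro ⟨u, v⟩ huv
    rw [Finset.HasAntidiagonal.mem_antidiagonal] at huv
    simp only at huv ⊢
    by_cases hne : coeff u (x : MvPolynomial (Fin e) K) * coeff v (y : MvPolynomial (Fin e) K) = 0
    · rw [coeff_linPart, coeff_linPart, hne]
      split_ifs <;> simp [hne]
    · obtain ⟨α, rfl⟩ := exists_expSum_of_coeff_ne_zero x (left_ne_zero_of_mul hne)
      obtain ⟨β, rfl⟩ := exists_expSum_of_coeff_ne_zero y (right_ne_zero_of_mul hne)
      have hα : expSum b α ≠ 0 := fun h => left_ne_zero_of_mul hne (by rw [h, hx])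
      have hβ : expSum b β ≠ 0 := fun h => right_ne_zero_of_mul hne (by rw [h, hy])
      have ho := hadd α β γ huv.symm
      rw [hγ] at ho
      have hα' : expSum b α ∈ irrExps b := by
        by_contra hc
        have := add_le_add (hnirr α hα hc) (hle β hβ)
        rw [← ho] at this
        norm_cast at this
        omega
      have hβ' : expSum b β ∈ irrExps b := by
        by_contra hc
        have := add_le_add (hle α hα) (hnirr β hβ hc)
        rw [← ho] at this
        norm_cast at this
        omega
      rw [coeff_linPart, coeff_linPart, if_pos hα', if_pos hβ']
  · by_contra hne
    rw [coeff_mul] at hne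
    obtain ⟨⟨u, v⟩, huv, h⟩ := Finset.exists_ne_zero_of_sum_ne_zero hne
    rw [Finset.HasAntidiagonal.mem_antidiagonal] at huv
    simp only at huv h
    rw [coeff_linPart, coeff_linPart] at h
    have hu : u ∈ irrExps b := by
      by_contra hc
      exact left_ne_zero_of_mul h (if_neg hc)
    have hv : v ∈ irrExps b := by
      by_contra hc
      exact right_ne_zero_of_mul h (if_neg hc)
    obtain ⟨α, rfl⟩ := hu.2.1
    obtain ⟨β, rfl⟩ := hv.2.1
    refine hs ⟨α + β, by rw [map_add, huv], ?_⟩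
    rw [hadd α β _ (map_add _ _ _), hirr α hu, hirr β hv, two_mul, Nat.cast_add]

theorem midpointFree_of_isSquarefreeToric (hq : QuadricConfig a) {D : ℕ} (hD : 0 < D)
    (hdeg : ∀ i, (a i).degree = D) (hs : IsSquarefreeToric K a) : MidpointFree a := by
  classical
  obtain ⟨p, e, b, hb, ⟨φ⟩⟩ := hs
  obtain ⟨ψ, hψ⟩ := exists_augmented_equiv hq hD hdeg φ
  have hχ : (toricAug K a).comp (ψ.symm : toricRing K b →ₐ[K] toricRing K a) = toricAug K b := by
    rw [← hψ]
    ext x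
    simp
  intro i j k h
  by_contra hji
  have haug : ∀ i, toricAug K b (ψ (toricGen K a i)) = 0 := by
    intro i
    have h1 := DFunLike.congr_fun hψ (toricGen K a i)
    have h0 : a i ≠ 0 := (mem_irrExps hD hdeg i).1
    rw [toricAug_apply (a := a), coe_toricGen, coeff_monomial, if_neg h0] at h1
    exact h1
  have hmul : ψ (toricGen K a i) * ψ (toricGen K a i) =
      ψ (toricGen K a j) * ψ (toricGen K a k) := by
    rw [← map_mul, ← map_mul]
    congr 1
    apply Subtype.ext
    simp [monomial_mul, h]
  have hlin : linPart (ψ (toricGen K a i)) * linPart (ψ (toricGen K a i)) =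
      linPart (ψ (toricGen K a j)) * linPart (ψ (toricGen K a k)) := by
    ext s
    have hc := fun x y hx hy => coeff_linPart_mul_linPart (K := K) (b := b) hD
      (o := monOrder (ψ.symm : toricRing K b →ₐ[K] toricRing K a))
      (fun α β γ h => monOrder_add _ h) (fun α hα => le_monOrder hdeg hχ hα)
      (fun α hα => monOrder_eq_of_mem_irrExps hD hdeg hq.inj hψ hχ hα) (x := x) (y := y) hx hy s
    rw [hc _ _ (haug i) (haug i), hc _ _ (haug j) (haug k), hmul]
  have hne : ∀ i, linPart (ψ (toricGen K a i)) ≠ 0 := by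
    intro i h0
    have : (Pi.single i 1 : Fin n → K) = 0 := by
      refine eq_zero_of_sum_coeff_eq_zero hq.inj hD hdeg ψ fun s hs => ?_
      have h1 := coeff_linPart (ψ (toricGen K a i)) s
      rw [h0, coeff_zero, if_pos hs] at h1
      simp [Pi.single_apply, ← h1]
    simpa using congrFun this i
  obtain ⟨c, hc⟩ := exists_eq_smul_of_mul_self_eq_mul (hne j) (hne k)
    (degreeOf_linPart_le hb _) (degreeOf_linPart_le hb _) hlin
  -- Proportional linear parts would be a linear dependence between the differentials of `u_i` and
  -- `u_j`.
  have : (Pi.single i 1 - c • Pi.single j 1 : Fin n → K) = 0 := by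
    refine eq_zero_of_sum_coeff_eq_zero hq.inj hD hdeg ψ fun s hs => ?_
    have h1 := coeff_linPart (ψ (toricGen K a i)) s
    rw [hc, coeff_smul, coeff_linPart, if_pos hs, if_pos hs, smul_eq_mul] at h1
    simp [Pi.single_apply, sub_mul, Finset.sum_sub_distrib, ← h1]
  have h2 := congrFun this i
  simp [Ne.symm hji] at h2

end LinearPart

theorem theorem2p1 {K : Type*} [Field K] {n d : ℕ} (a : Fin n → Fin d →₀ ℕ)
    (ha : Function.Injective a) (D : ℕ) (hD : 0 < D) (hdeg : ∀ i, (a i).degree = D)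
    (hK : IsStronglyKoszulToric K a) :
    List.TFAE
      [IsSquarefreeToric K a,
       ¬ ∃ i j k : Fin n, (X i ^ 2 - X j * X k : MvPolynomial (Fin n) K) ≠ 0 ∧
          (X i ^ 2 - X j * X k : MvPolynomial (Fin n) K) ∈ toricIdeal K a,
       IsCompressedToric K a] ∧
    (IsSquarefreeToric K a → IsCompressedToric K a) := by
  have hq := quadricConfig_of_isStronglyKoszulToric ha hD hdeg hK
  rw [not_exists_sq_sub_mem_toricIdeal_iff ha]
  have h12 : IsSquarefreeToric K a → MidpointFree a :=
    midpointFree_of_isSquarefreeToric hq hD hdeg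
  have h23 : MidpointFree a → IsCompressedToric K a := fun hm =>
    isCompressedToric_of_midpointFree hq hm hD hdeg
  refine ⟨?_, fun h => h23 (h12 h)⟩
  tfae_have 1 → 2 := h12
  tfae_have 2 → 1 := isSquarefreeToric_of_midpointFree hq
  tfae_have 2 → 3 := h23
  tfae_have 3 → 2 := midpointFree_of_isCompressedToric ha hD hdeg
  tfae_finish
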